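/- A graph is a finite directed multigraph without loops. It is $D$-bounded if every vertex has total degree (in-degree plus out-degree, with multiplicity) at most $D$. A $k$-colored graph $(G,\chi)$ is a graph $G=(V,E)$ with a proper coloring $\chi:V\to[k]$, i.e. $\chi(u)\ne\chi(v)$ for every edge $(u,v)\in E$. For $e=(u,v)\in E$ and $\ell\in\mathbb N$, let $N$ be the set of vertices joined to $u$ or to $v$ by a path (ignoring edge directions) of length at most $\ell$; the radius-$\ell$ neighborhood type of $e$ is the isomorphism class of the induced colored multigraph $(G[N],\chi|_N)$ with designated ordered root edge $e$ (isomorphisms preserve edge multiplicities, colors and the root edge). Let $\mathcal T_{k,\ell,D}$ be the set of isomorphism classes of $D$-bounded $k$-colored graphs with a designated root edge in which every vertex is at distance at most $\ell$ from an endpoint of the root edge. For a $D$-bounded $k$-colored graph $(G,\chi)$ with $E\neq\emptyset$, let $\mathrm{EdgeDist}^{\ell}_{G,\chi}$ be the distribution on $\mathcal T_{k,\ell,D}$ of the radius-$\ell$ neighborhood type of a uniformly random edge $e$ of $E$ (counted with multiplicity). The total variation distance is $\mathrm{tv}(\mathcal X,\mathcal Y)=\frac12\sum_s|\mathcal X(s)-\mathcal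 Y(s)|$. A randomized streaming algorithm is a single program, the same for all $n$, $G$ and $\chi$, whose memory initially holds $n$. In each step it computes from its memory alone one of the following actions: read the next stream item, query the color of a vertex, toss a fair coin, or stop with an output. It then replaces its memory by a computable function of the memory and of the answer received. Its space is the number of bits of memory held between steps. **Theorem.** For all $k,\ell,D\in\mathbb N$ and $\varepsilon,\delta>0$, the set $\mathcal T_{k,\ell,D}$ is finite and there is $c>0$ such that the following holds. There exists an $O(n^{1-c})$-space randomized streaming algorithm (where the implied constant may depend on $k,\ell,D,\varepsilon,\delta$, and the space bound holds at every moment and for every outcome of the coins) that always stops and that, for every $n$, every $D$-bounded $k$-colored graph $(G=([n],E),\chi:[n]\to[k])$ with at least one edge, and every ordering of $E$, given $n$, query access to $\chi$ and a single pass over $E$ in this order, outputs with probability at least $1-\delta$ a distribution $\mathcal D$ on $\mathcal T_{k,\ell,D}$ with $$\mathrm{tv}\bigl(\mathcal D,\ \mathrm{EdgeDist}^{\ell}_{G,\chi}\bigr)\le\varepsilon .$$ -/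

import Mathlib

/-! ### Directed multigraphs -/

/-- A directed multigraph without loops on a finite set of vertices (named by natural numbers). -/
structure MGraph where
  V : Finset ℕ
  E : Multiset (ℕ × ℕ)
  mem_left : ∀ e ∈ E, e.1 ∈ V
  mem_right : ∀ e ∈ E, e.2 ∈ V
  loopless : ∀ e ∈ E, e.1 ≠ e.2

namespace MGraph

/-- Total degree of a vertex, with multiplicities. -/
def degree (G : MGraph) (v : ℕ) : ℕ := ∑ u ∈ G.V, (G.E.count (u, v) + G.E.count (v, u))

/-- The maximum degree is at most `D`. -/
def IsBounded (G : MGraph) (D : ℕ) : Prop := ∀ v ∈ G.V, G.degree v ≤ D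

/-- Adjacency, ignoring the direction of edges. -/
def Adj (G : MGraph) (u v : ℕ) : Prop := (u, v) ∈ G.E ∨ (v, u) ∈ G.E

/-- There is a path of length `L` from `u` to `v`. -/
def HasPath (G : MGraph) (L u v : ℕ) : Prop :=
  ∃ w : ℕ → ℕ, w 0 = u ∧ w L = v ∧ ∀ i < L, G.Adj (w i) (w (i + 1))

open Classical in
/-- The vertices joined to `v` by a path of length at most `ℓ`. -/
noncomputable def ball (G : MGraph) (ℓ v : ℕ) : Finset ℕ :=
  G.V.filter fun u => ∃ L ≤ ℓ, G.HasPath L v u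

/-- The union of the balls around the two endpoints of `e`. -/
noncomputable def edgeBall (G : MGraph) (ℓ : ℕ) (e : ℕ × ℕ) : Finset ℕ :=
  G.ball ℓ e.1 ∪ G.ball ℓ e.2

/-- The subgraph induced on `U` (meant for `U ⊆ G.V`). -/
def induce (G : MGraph) (U : Finset ℕ) : MGraph where
  V := G.V ∩ U
  E := G.E.filter fun e => e.1 ∈ U ∧ e.2 ∈ U
  mem_left e he := by
    rw [Multiset.mem_filter] at he
    exact Finset.mem_inter.2 ⟨G.mem_left e he.1, he.2.1⟩
  mem_right e he := by
    rw [Multiset.mem_filter] at he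
    exact Finset.mem_inter.2 ⟨G.mem_right e he.1, he.2.2⟩
  loopless e he := G.loopless e (Multiset.mem_filter.1 he).1

theorem self_mem_ball (G : MGraph) (ℓ : ℕ) {v : ℕ} (hv : v ∈ G.V) : v ∈ G.ball ℓ v := by
  classical
  refine Finset.mem_filter.2 ⟨hv, 0, Nat.zero_le _, fun _ => v, rfl, rfl, ?_⟩
  intro i hi
  exact absurd hi (Nat.not_lt_zero i)

end MGraph

/-- A properly `k`-colored graph with colors `1, …, k`; values of `χ` outside `V` are immaterial. -/
structure ColoredGraph (k : ℕ) extends MGraph where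
  χ : ℕ → ℕ
  color_mem : ∀ v ∈ V, χ v ∈ Finset.Icc 1 k
  proper : ∀ e ∈ E, χ e.1 ≠ χ e.2

/-- The induced subgraph with the restricted coloring. -/
def ColoredGraph.restrict {k : ℕ} (G : ColoredGraph k) (U : Finset ℕ) : ColoredGraph k where
  toMGraph := G.toMGraph.induce U
  χ := G.χ
  color_mem v hv := G.color_mem v (Finset.mem_inter.1 hv).1
  proper e he := G.proper e (Multiset.mem_filter.1 he).1

/-! ### Edge neighborhood types -/

/-- A doubly rooted properly `k`-colored graph: its roots are the endpoints of a designated edge. -/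
structure DRGraph (k : ℕ) extends ColoredGraph k where
  root : ℕ × ℕ
  root_mem : root ∈ E

/-- Isomorphism: a bijection of the vertex sets that preserves edge multiplicities, colors and the
(ordered) root edge. -/
def DRGraph.Iso {k : ℕ} (H H' : DRGraph k) : Prop :=
  ∃ φ : {v // v ∈ H.V} ≃ {v // v ∈ H'.V},
    (∀ u v, H.E.count (u.1, v.1) = H'.E.count ((φ u).1, (φ v).1)) ∧
    (∀ v, H.χ v.1 = H'.χ (φ v).1) ∧
    (φ ⟨H.root.1, H.mem_left _ H.root_mem⟩).1 = H'.root.1 ∧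
    (φ ⟨H.root.2, H.mem_right _ H.root_mem⟩).1 = H'.root.2

theorem DRGraph.iso_equivalence (k : ℕ) : Equivalence (@DRGraph.Iso k) where
  refl H := ⟨Equiv.refl _, fun _ _ => rfl, fun _ => rfl, rfl, rfl⟩
  symm := by
    rintro H H' ⟨φ, h1, h2, h3, h4⟩
    refine ⟨φ.symm, fun u v => ?_, fun v => ?_, ?_, ?_⟩
    · rw [h1, φ.apply_symm_apply, φ.apply_symm_apply]
    · rw [h2, φ.apply_symm_apply]
    · have : φ ⟨H.root.1, H.mem_left _ H.root_mem⟩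
          = ⟨H'.root.1, H'.mem_left _ H'.root_mem⟩ := Subtype.ext h3
      rw [← this, φ.symm_apply_apply]
    · have : φ ⟨H.root.2, H.mem_right _ H.root_mem⟩
          = ⟨H'.root.2, H'.mem_right _ H'.root_mem⟩ := Subtype.ext h4
      rw [← this, φ.symm_apply_apply]
  trans := by
    rintro H H' H'' ⟨φ, h1, h2, h3, h4⟩ ⟨ψ, g1, g2, g3, g4⟩
    refine ⟨φ.trans ψ, fun u v => ?_, fun v => ?_, ?_, ?_⟩
    · rw [h1, g1]; rfl
    · rw [h2, g2]; rfl
    · have : φ ⟨H.root.1, H.mem_left _ H.root_mem⟩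
          = ⟨H'.root.1, H'.mem_left _ H'.root_mem⟩ := Subtype.ext h3
      rw [Equiv.trans_apply, this, g3]
    · have : φ ⟨H.root.2, H.mem_right _ H.root_mem⟩
          = ⟨H'.root.2, H'.mem_right _ H'.root_mem⟩ := Subtype.ext h4
      rw [Equiv.trans_apply, this, g4]

def DRGraph.setoid (k : ℕ) : Setoid (DRGraph k) := ⟨DRGraph.Iso, DRGraph.iso_equivalence k⟩

/-- Isomorphism classes of doubly rooted properly `k`-colored graphs. -/
def EdgeType (k : ℕ) : Type := Quotient (DRGraph.setoid k)

/-- The type (isomorphism class) of a doubly rooted colored graph. -/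
def DRGraph.type {k : ℕ} (H : DRGraph k) : EdgeType k := Quotient.mk (DRGraph.setoid k) H

/-- The isomorphism classes of `D`-bounded doubly rooted `k`-colored graphs all of whose vertices
have distance at most `ℓ` from at least one of the roots. -/
def dbTypes (k ℓ D : ℕ) : Set (EdgeType k) :=
  {T | ∃ H : DRGraph k, H.type = T ∧ H.IsBounded D ∧ ∀ v ∈ H.V, v ∈ H.edgeBall ℓ H.root}

/-- The radius-`ℓ` neighborhood of an edge, rooted at this edge. -/
noncomputable def ColoredGraph.nbhd {k : ℕ} (G : ColoredGraph k) (ℓ : ℕ) (e : ℕ × ℕ)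
    (he : e ∈ G.E) : DRGraph k where
  toColoredGraph := G.restrict (G.edgeBall ℓ e)
  root := e
  root_mem := Multiset.mem_filter.2 ⟨he,
    Finset.mem_union_left _ (G.self_mem_ball ℓ (G.mem_left e he)),
    Finset.mem_union_right _ (G.self_mem_ball ℓ (G.mem_right e he))⟩

/-- The radius-`ℓ` neighborhood type of an edge. -/
noncomputable def ColoredGraph.nbrType {k : ℕ} (G : ColoredGraph k) (ℓ : ℕ) (e : ℕ × ℕ)
    (he : e ∈ G.E) : EdgeType k := (G.nbhd ℓ e he).type

open Classical in
/-- The radius-`ℓ` edge-type distribution: the probability that a uniformly random edge (counted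
with multiplicity) has type `T`. Meaningful for graphs with at least one edge. -/
noncomputable def ColoredGraph.edgeDist {k : ℕ} (G : ColoredGraph k) (ℓ : ℕ) (T : EdgeType k) : ℝ :=
  (G.E.countP fun e => ∃ he : e ∈ G.E, G.nbrType ℓ e he = T : ℕ) / (Multiset.card G.E : ℝ)

/-- Total variation distance on a finite set. -/
noncomputable def tvDist {S : Type*} [Fintype S] (P Q : S → ℝ) : ℝ := (1 / 2) * ∑ s, |P s - Q s|

/-- The distribution on `N` points with probabilities proportional to the first `N` entries of `w`
(a distribution whenever these entries are not all zero). -/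
noncomputable def weightDist (N : ℕ) (w : List ℕ) (i : Fin N) : ℝ :=
  (w.getD i 0 : ℝ) / ∑ j : Fin N, (w.getD j 0 : ℝ)

/-! ### Single-pass streaming algorithms with oracle access to a coloring -/

/-- What an algorithm can do next: ask for the next stream item, ask for the color of a vertex, toss
a fair coin, or stop with an output. -/
inductive StreamAction where
  | read
  | query (v : ℕ)
  | toss
  | output (w : List ℕ)

def StreamAction.equiv : StreamAction ≃ Bool ⊕ (ℕ ⊕ List ℕ) where
  toFun
    | .read => .inl false
    | .toss => .inl true
    | .query v => .inr (.inl v)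
    | .output w => .inr (.inr w)
  invFun
    | .inl false => .read
    | .inl true => .toss
    | .inr (.inl v) => .query v
    | .inr (.inr w) => .output w
  left_inv a := by cases a <;> rfl
  right_inv a := by rcases a with (_ | _) | _ | _ <;> rfl

instance : Primcodable StreamAction := Primcodable.ofEquiv _ StreamAction.equiv

/-- The program of a streaming algorithm. The memory is a list of natural numbers. Two computable
functions, which are the same for all `n`, all graphs and all colorings, determine the next action
from the memory alone, and the new memory from the memory and the answer to that action. -/
structure StreamAlg where
  action : List ℕ → StreamAction
  update : List ℕ → List ℕ → List ℕ
  action_computable : Computable action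
  update_computable : Computable₂ update

/-- The number of bits in the memory: each cell costs its binary length plus a separator. -/
def memBits (M : List ℕ) : ℕ := (M.map fun a => Nat.size a + 1).sum

namespace StreamAlg

/-- One step. A configuration consists of the memory and of the unread part of the stream; `b` is the
coin of this step (seen only if the algorithm tosses a coin). The answer to `read` is the next edge
`[u, v]`, which is then gone, or `[]` at the end of the stream; the answer to `query v` is the color
of `v` (`0` if `v` is not a vertex). After an output nothing changes any more. -/
def step (A : StreamAlg) (n : ℕ) (χ : ℕ → ℕ) (c : List ℕ × List (ℕ × ℕ)) (b : Bool) :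
    List ℕ × List (ℕ × ℕ) :=
  match A.action c.1, c.2 with
  | .read, [] => (A.update c.1 [], [])
  | .read, e :: σ => (A.update c.1 [e.1, e.2], σ)
  | .query v, σ => (A.update c.1 [if v ∈ Finset.Icc 1 n then χ v else 0], σ)
  | .toss, σ => (A.update c.1 [b.toNat], σ)
  | .output _, σ => (c.1, σ)

/-- The memory after `coins.length` steps with these coins, on the stream `σ` of edges of a graph on
`{1, …, n}` colored by `χ`. At the start the memory holds just `n`. -/
def memory (A : StreamAlg) (n : ℕ) (χ : ℕ → ℕ) (σ : List (ℕ × ℕ)) (coins : List Bool) : List ℕ :=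
  (coins.foldl (A.step n χ) ([n], σ)).1

end StreamAlg

open Classical in
/-- The probability of an event that depends on `t` independent fair coins. -/
noncomputable def coinProb (t : ℕ) (P : List Bool → Prop) : ℝ :=
  ((Finset.univ.filter fun ω : Fin t → Bool => P (List.ofFn ω)).card : ℝ) / 2 ^ t

/-! Before the stream starts, each vertex is sampled independently with probability `q = 2 ^ (-r)`.
During the pass, the first `keepBound` edges and all edges that meet the sample are recorded,
together with the colors of their endpoints. If all vertices of the ball around an edge are sampled,
then every edge that meets this ball is recorded, and the type of the edge can be read off the
records. An edge whose ball has `b` vertices is seen in this way with probability `q ^ b`. The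
number of seen edges of a given type, times `2 ^ (r * b)`, is therefore an unbiased estimate of the
number of edges of this type.

Bounded degree controls the variance. A ball has at most `B = 2 * (D + 1) ^ ℓ` vertices and meets
boundedly many others, and edges with disjoint balls are seen independently. By Chebyshev's
inequality (`card_deviation_le`, `card_bad_le`), for `m` edges the estimate is off by at least `θ *
m` with probability `O(1 / (θ ^ 2 * m * q ^ b))`. This is small once `m` is at least a large
constant `Q` times `q ^ (-B)`. A shorter stream fits into the first `keepBound` records, and then
all counts are exact.

The choice of `q` near `n ^ (-1 / (2 * B))` makes `q ^ (-B)` about `√n`, while the sample has about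
`n ^ (1 - 1 / (2 * B))` vertices. A hard cap on the number of records gives the space bound for all
coins. By Markov's inequality the cap rarely matters. The logarithmic size of a record costs the
passage from `1 / (2 * B)` to `1 / (4 * B)` in the exponent.

Recognizing a type from records is the combinatorial part (`exists_matches_iff`). Vertices at
distance less than `ℓ` from the root edge must have all their neighbors in the image of the
embedding; vertices on the boundary may have others. This makes the image equal to the ball. The
condition involves only edges that meet the ball (`Pattern.matches_congr`), and it is checked by a
finite, primitive recursive search. -/

/-! ### Walks, balls and degree counts in bounded multigraphs -/

namespace MGraph

theorem Adj.symm {G : MGraph} {u v : ℕ} (h : G.Adj u v) : G.Adj v u := Or.symm h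

theorem Adj.left_mem {G : MGraph} {u v : ℕ} (h : G.Adj u v) : u ∈ G.V :=
  h.elim (G.mem_left _) (G.mem_right _)

theorem Adj.right_mem {G : MGraph} {u v : ℕ} (h : G.Adj u v) : v ∈ G.V := h.symm.left_mem

theorem hasPath_zero {G : MGraph} {u v : ℕ} : G.HasPath 0 u v ↔ u = v := by
  constructor
  · rintro ⟨w, h0, h1, -⟩
    exact h0.symm.trans h1
  · rintro rfl
    exact ⟨fun _ => u, rfl, rfl, fun i hi => absurd hi (Nat.not_lt_zero i)⟩

theorem hasPath_succ {G : MGraph} {L u v : ℕ} :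
    G.HasPath (L + 1) u v ↔ ∃ z, G.HasPath L u z ∧ G.Adj z v := by
  constructor
  · rintro ⟨w, h0, h1, h⟩
    exact ⟨w L, ⟨w, h0, rfl, fun i hi => h i (by omega)⟩, h1 ▸ h L (by omega)⟩
  · rintro ⟨z, ⟨w, h0, h1, h⟩, hz⟩
    refine ⟨fun i => if i ≤ L then w i else v, by simpa using h0, by simp, fun i hi => ?_⟩
    rcases Nat.lt_or_ge i L with hl | hl
    · simpa [hl.le, Nat.succ_le_of_lt hl] using h i hl
    · have : i = L := by omega
      subst this
      simpa [h1] using hz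

theorem HasPath.symm {G : MGraph} {L u v : ℕ} (h : G.HasPath L u v) : G.HasPath L v u := by
  obtain ⟨w, h0, h1, h⟩ := h
  refine ⟨fun i => w (L - i), by simpa using h1, by simpa using h0, fun i hi => ?_⟩
  have := (h (L - (i + 1)) (by omega)).symm
  rwa [show L - (i + 1) + 1 = L - i by omega] at this

theorem HasPath.right_mem {G : MGraph} {L u v : ℕ} (h : G.HasPath L u v) (hu : u ∈ G.V) :
    v ∈ G.V := by
  cases L with
  | zero => exact hasPath_zero.1 h ▸ hu
  | succ L =>
    obtain ⟨z, -, hz⟩ := hasPath_succ.1 h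
    exact hz.right_mem

theorem HasPath.map {G G' : MGraph} {f : ℕ → ℕ} (hf : ∀ a b, G.Adj a b → G'.Adj (f a) (f b))
    {L u v : ℕ} (h : G.HasPath L u v) : G'.HasPath L (f u) (f v) := by
  obtain ⟨w, h0, h1, h⟩ := h
  exact ⟨f ∘ w, congrArg f h0, congrArg f h1, fun i hi => hf _ _ (h i hi)⟩

theorem mem_ball {G : MGraph} {ℓ u v : ℕ} :
    u ∈ G.ball ℓ v ↔ u ∈ G.V ∧ ∃ L ≤ ℓ, G.HasPath L v u := by
  classical
  simp [ball]

theorem mem_edgeBall {G : MGraph} {ℓ u : ℕ} {e : ℕ × ℕ} :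
    u ∈ G.edgeBall ℓ e ↔
      u ∈ G.V ∧ ∃ L ≤ ℓ, G.HasPath L e.1 u ∨ G.HasPath L e.2 u := by
  rw [edgeBall, Finset.mem_union, mem_ball, mem_ball]
  constructor
  · rintro (⟨h, L, hL, h'⟩ | ⟨h, L, hL, h'⟩)
    · exact ⟨h, L, hL, .inl h'⟩
    · exact ⟨h, L, hL, .inr h'⟩
  · rintro ⟨h, L, hL, h' | h'⟩
    · exact .inl ⟨h, L, hL, h'⟩
    · exact .inr ⟨h, L, hL, h'⟩

theorem edgeBall_subset (G : MGraph) (ℓ : ℕ) (e : ℕ × ℕ) : G.edgeBall ℓ e ⊆ G.V :=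
  fun _ h => (mem_edgeBall.1 h).1

/-- Double counting: an edge with the property `p` is counted only at `u = g e`, any other edge
nowhere. It turns the sums that define degrees into counts of edges. -/
theorem sum_count_eq_countP {α β : Type*} [DecidableEq α] [DecidableEq β] (V : Finset β)
    (f : β → α) (g : α → β) (hgf : ∀ b, g (f b) = b) (p : α → Prop) [DecidablePred p]
    (hp : ∀ a, p a ↔ f (g a) = a) (E : Multiset α) (hE : ∀ e ∈ E, g e ∈ V) :
    ∑ u ∈ V, E.count (f u) = E.countP p := by
  induction E using Multiset.induction_on with
  | empty => simp
  | cons a E ih =>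
    simp only [Multiset.count_cons, Finset.sum_add_distrib, Multiset.countP_cons]
    rw [ih fun e he => hE e (Multiset.mem_cons_of_mem he)]
    congr 1
    by_cases h : p a
    · rw [if_pos h, Finset.sum_eq_single (g a)]
      · rw [if_pos ((hp a).1 h)]
      · rintro b - hb
        rw [if_neg]
        rintro rfl
        exact hb (hgf b).symm
      · intro h'
        exact absurd (hE a (Multiset.mem_cons_self a E)) h'
    · rw [if_neg h]
      refine Finset.sum_eq_zero fun b _ => if_neg ?_
      rintro rfl
      exact h ((hp _).2 (by rw [hgf]))

theorem degree_eq (G : MGraph) (v : ℕ) :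
    G.degree v = G.E.countP (fun e => e.2 = v) + G.E.countP (fun e => e.1 = v) := by
  rw [degree, Finset.sum_add_distrib,
    sum_count_eq_countP G.V (fun u => (u, v)) Prod.fst (fun _ => rfl) (fun e => e.2 = v)
      (fun a => by rw [Prod.ext_iff]; simp [eq_comm]) G.E G.mem_left,
    sum_count_eq_countP G.V (fun u => (v, u)) Prod.snd (fun _ => rfl) (fun e => e.1 = v)
      (fun a => by rw [Prod.ext_iff]; simp [eq_comm]) G.E G.mem_right]

/-- The number of edges that meet `U` is at most the sum of the degrees in `U`. -/
theorem countP_touch_le (G : MGraph) (U : Finset ℕ) :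
    G.E.countP (fun e => e.1 ∈ U ∨ e.2 ∈ U) ≤ ∑ v ∈ U, G.degree v := by
  simp only [degree_eq]
  generalize G.E = E
  induction E using Multiset.induction_on with
  | empty => simp
  | cons a E ih =>
    simp only [Multiset.countP_cons, Finset.sum_add_distrib, Finset.sum_ite_eq] at ih ⊢
    split_ifs <;> first | omega | (exfalso; tauto)

theorem countP_touch_le_mul {G : MGraph} {D : ℕ} (hG : G.IsBounded D) {U : Finset ℕ}
    (hU : U ⊆ G.V) : G.E.countP (fun e => e.1 ∈ U ∨ e.2 ∈ U) ≤ D * U.card := by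
  refine (G.countP_touch_le U).trans ?_
  rw [mul_comm]
  exact (Finset.sum_le_card_nsmul U _ D fun v hv => hG v (hU hv)).trans (by simp)

theorem card_edges_le {G : MGraph} {D : ℕ} (hG : G.IsBounded D) :
    Multiset.card G.E ≤ D * G.V.card := by
  refine le_trans (le_of_eq ?_) (countP_touch_le_mul hG (Finset.Subset.refl _))
  exact (Multiset.countP_eq_card.2 fun e he => .inl (G.mem_left e he)).symm

theorem count_le_degree (G : MGraph) (u v : ℕ) : G.E.count (u, v) ≤ G.degree v := by
  rw [degree_eq]
  refine le_trans ?_ (Nat.le_add_right _ _)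
  rw [Multiset.count, Multiset.countP_eq_card_filter, Multiset.countP_eq_card_filter]
  exact Multiset.card_le_card (Multiset.monotone_filter_right _ (by rintro _ rfl; rfl))

open Classical in
theorem card_nbrs_le (G : MGraph) (v : ℕ) : (G.V.filter fun u => G.Adj v u).card ≤ G.degree v := by
  rw [Finset.card_filter, degree]
  refine Finset.sum_le_sum fun u _ => ?_
  split_ifs with h
  · rcases h with h | h
    · have := Multiset.one_le_count_iff_mem.2 h
      omega
    · have := Multiset.one_le_count_iff_mem.2 h
      omega
  · exact Nat.zero_le _

/-- A ball grows by a factor of at most `D + 1` per step, since each of its vertices contributes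
itself and at most `D` neighbors. -/
theorem card_ball_le {G : MGraph} {D : ℕ} (hG : G.IsBounded D) (ℓ v : ℕ) :
    (G.ball ℓ v).card ≤ (D + 1) ^ ℓ := by
  classical
  induction ℓ with
  | zero =>
    rw [pow_zero, Finset.card_le_one]
    intro a ha b hb
    obtain ⟨-, L, hL, ha⟩ := mem_ball.1 ha
    obtain ⟨-, L', hL', hb⟩ := mem_ball.1 hb
    obtain rfl : L = 0 := by omega
    obtain rfl : L' = 0 := by omega
    rw [← hasPath_zero.1 ha, ← hasPath_zero.1 hb]
  | succ ℓ ih =>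
    have hsub : G.ball (ℓ + 1) v ⊆
        (G.ball ℓ v).biUnion fun u => insert u (G.V.filter fun z => G.Adj u z) := by
      intro z hz
      obtain ⟨hzV, L, hL, hz⟩ := mem_ball.1 hz
      rw [Finset.mem_biUnion]
      rcases Nat.lt_or_ge ℓ L with hl | hl
      · obtain rfl : L = ℓ + 1 := by omega
        obtain ⟨u, hu, huz⟩ := hasPath_succ.1 hz
        exact ⟨u, mem_ball.2 ⟨huz.left_mem, ℓ, le_rfl, hu⟩,
          Finset.mem_insert_of_mem (Finset.mem_filter.2 ⟨hzV, huz⟩)⟩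
      · exact ⟨z, mem_ball.2 ⟨hzV, L, hl, hz⟩, Finset.mem_insert_self _ _⟩
    calc (G.ball (ℓ + 1) v).card ≤ _ := Finset.card_le_card hsub
      _ ≤ (G.ball ℓ v).card * (D + 1) := by
        refine Finset.card_biUnion_le_card_mul _ _ _ fun u hu => ?_
        exact (Finset.card_insert_le _ _).trans
          (Nat.succ_le_succ ((G.card_nbrs_le u).trans (hG u (mem_ball.1 hu).1)))
      _ ≤ _ := by rw [pow_succ]; exact Nat.mul_le_mul_right _ ih

theorem card_edgeBall_le {G : MGraph} {D : ℕ} (hG : G.IsBounded D) (ℓ : ℕ) (e : ℕ × ℕ) :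
    (G.edgeBall ℓ e).card ≤ 2 * (D + 1) ^ ℓ := by
  refine (Finset.card_union_le _ _).trans ?_
  have h1 := card_ball_le hG ℓ e.1
  have h2 := card_ball_le hG ℓ e.2
  omega

/-- Edges whose ball contains `v` meet the ball around `v`. -/
theorem touch_of_mem_edgeBall {G : MGraph} {ℓ v : ℕ} {e : ℕ × ℕ} (he : e ∈ G.E)
    (hv : v ∈ G.edgeBall ℓ e) : e.1 ∈ G.ball ℓ v ∨ e.2 ∈ G.ball ℓ v := by
  obtain ⟨-, L, hL, h | h⟩ := mem_edgeBall.1 hv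
  · exact .inl (mem_ball.2 ⟨G.mem_left e he, L, hL, h.symm⟩)
  · exact .inr (mem_ball.2 ⟨G.mem_right e he, L, hL, h.symm⟩)

/-- By symmetry of walks, an edge whose ball contains `v` has an endpoint in the ball around `v`,
and few edges meet that ball. This bounds the dependencies in the variance estimate. -/
theorem countP_mem_edgeBall_le {G : MGraph} {D : ℕ} (hG : G.IsBounded D) (ℓ v : ℕ) :
    G.E.countP (fun e => v ∈ G.edgeBall ℓ e) ≤ D * (D + 1) ^ ℓ := by
  classical
  have hsub : G.ball ℓ v ⊆ G.V := fun _ h => (mem_ball.1 h).1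
  refine le_trans ?_ ((countP_touch_le_mul hG hsub).trans
    (Nat.mul_le_mul_left _ (card_ball_le hG ℓ v)))
  rw [Multiset.countP_eq_card_filter, Multiset.countP_eq_card_filter]
  have : G.E.filter (fun e => v ∈ G.edgeBall ℓ e) ≤
      G.E.filter (fun e => e.1 ∈ G.ball ℓ v ∨ e.2 ∈ G.ball ℓ v) := by
    rw [Multiset.le_filter]
    exact ⟨Multiset.filter_le _ _, fun e he =>
      touch_of_mem_edgeBall (Multiset.mem_filter.1 he).1 (Multiset.mem_filter.1 he).2⟩
  exact Multiset.card_le_card this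

theorem Adj.induce {G : MGraph} {U : Finset ℕ} {u v : ℕ} (h : G.Adj u v) (hu : u ∈ U)
    (hv : v ∈ U) : (G.induce U).Adj u v :=
  h.imp (fun h => Multiset.mem_filter.2 ⟨h, hu, hv⟩) fun h => Multiset.mem_filter.2 ⟨h, hv, hu⟩

theorem Adj.of_induce {G : MGraph} {U : Finset ℕ} {u v : ℕ} (h : (G.induce U).Adj u v) :
    G.Adj u v :=
  h.imp (fun h => (Multiset.mem_filter.1 h).1) fun h => (Multiset.mem_filter.1 h).1

theorem HasPath.of_induce {G : MGraph} {U : Finset ℕ} {L u v : ℕ}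
    (h : (G.induce U).HasPath L u v) : G.HasPath L u v :=
  h.map (f := id) fun _ _ h => h.of_induce

theorem count_induce (G : MGraph) {U : Finset ℕ} {u v : ℕ} (hu : u ∈ U) (hv : v ∈ U) :
    (G.induce U).E.count (u, v) = G.E.count (u, v) :=
  Multiset.count_filter_of_pos ⟨hu, hv⟩

theorem IsBounded.induce {G : MGraph} {D : ℕ} (hG : G.IsBounded D) (U : Finset ℕ) :
    (G.induce U).IsBounded D := by
  intro v hv
  refine le_trans ?_ (hG v (Finset.mem_inter.1 hv).1)
  rw [degree_eq, degree_eq]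
  have : (G.induce U).E ≤ G.E := Multiset.filter_le _ _
  exact Nat.add_le_add (Multiset.countP_le_of_le _ this) (Multiset.countP_le_of_le _ this)

/-- Every prefix of a walk of length at most `ℓ` ends in the ball, so the walk never leaves `U`. -/
theorem HasPath.induce_of_ball {G : MGraph} {U : Finset ℕ} {ℓ u : ℕ}
    (hU : G.ball ℓ u ⊆ U) {L v : ℕ} (hL : L ≤ ℓ) (h : G.HasPath L u v) :
    (G.induce U).HasPath L u v := by
  induction L generalizing v with
  | zero => exact hasPath_zero.2 (hasPath_zero.1 h)
  | succ L ih =>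
    obtain ⟨z, hz, hzv⟩ := hasPath_succ.1 h
    refine hasPath_succ.2 ⟨z, ih (by omega) hz, hzv.induce (hU ?_) (hU ?_)⟩
    · exact mem_ball.2 ⟨hzv.left_mem, L, by omega, hz⟩
    · exact mem_ball.2 ⟨hzv.right_mem, L + 1, hL, h⟩

end MGraph

/-! ### Neighborhood types and their finiteness -/

namespace ColoredGraph

variable {k : ℕ} (G : ColoredGraph k)

theorem nbhd_V (ℓ : ℕ) (e : ℕ × ℕ) (he : e ∈ G.E) : (G.nbhd ℓ e he).V = G.edgeBall ℓ e :=
  Finset.inter_eq_right.2 (G.edgeBall_subset ℓ e)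

theorem mem_edgeBall_nbhd (ℓ : ℕ) (e : ℕ × ℕ) (he : e ∈ G.E) {v : ℕ}
    (hv : v ∈ (G.nbhd ℓ e he).V) : v ∈ (G.nbhd ℓ e he).edgeBall ℓ e := by
  have hv' := hv
  rw [nbhd_V, MGraph.mem_edgeBall] at hv'
  obtain ⟨-, L, hL, h⟩ := hv'
  refine MGraph.mem_edgeBall.2 ⟨hv, L, hL, h.imp (fun h => ?_) fun h => ?_⟩
  · exact h.induce_of_ball Finset.subset_union_left hL
  · exact h.induce_of_ball Finset.subset_union_right hL

theorem nbrType_mem_dbTypes {D : ℕ} (hG : G.IsBounded D) (ℓ : ℕ) (e : ℕ × ℕ) (he : e ∈ G.E) :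
    G.nbrType ℓ e he ∈ dbTypes k ℓ D :=
  ⟨G.nbhd ℓ e he, rfl, MGraph.IsBounded.induce hG _, fun _ hv => G.mem_edgeBall_nbhd ℓ e he hv⟩

end ColoredGraph

theorem DRGraph.card_eq_of_iso {k : ℕ} {H H' : DRGraph k} (h : H.Iso H') :
    H.V.card = H'.V.card := by
  obtain ⟨φ, -⟩ := h
  simpa using Fintype.card_congr φ

theorem DRGraph.type_eq_iff {k : ℕ} {H H' : DRGraph k} : H.type = H'.type ↔ H.Iso H' :=
  ⟨fun h => Quotient.exact h, fun h => Quotient.sound h⟩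

/-- Rooted colored graphs with vertices named by `Fin b` through `η` are determined up to
isomorphism by their edge multiplicities, colors and roots. -/
theorem DRGraph.iso_of_equiv {k b : ℕ} {H H' : DRGraph k} (η : Fin b ≃ {v // v ∈ H.V})
    (η' : Fin b ≃ {v // v ∈ H'.V})
    (hc : ∀ i j, H.E.count ((η i).1, (η j).1) = H'.E.count ((η' i).1, (η' j).1))
    (hχ : ∀ i, H.χ (η i).1 = H'.χ (η' i).1)
    (h1 : η.symm ⟨H.root.1, H.mem_left _ H.root_mem⟩
      = η'.symm ⟨H'.root.1, H'.mem_left _ H'.root_mem⟩)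
    (h2 : η.symm ⟨H.root.2, H.mem_right _ H.root_mem⟩
      = η'.symm ⟨H'.root.2, H'.mem_right _ H'.root_mem⟩) : H.Iso H' := by
  refine ⟨η.symm.trans η', fun u v => ?_, fun v => ?_, ?_, ?_⟩
  · simpa using hc (η.symm u) (η.symm v)
  · simpa using hχ (η.symm v)
  · rw [Equiv.trans_apply, h1, Equiv.apply_symm_apply]
  · rw [Equiv.trans_apply, h2, Equiv.apply_symm_apply]

theorem DRGraph.card_V_le {k ℓ D : ℕ} {H : DRGraph k} (hb : H.IsBounded D)
    (hℓ : ∀ v ∈ H.V, v ∈ H.edgeBall ℓ H.root) : H.V.card ≤ 2 * (D + 1) ^ ℓ :=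
  (Finset.card_le_card hℓ).trans (MGraph.card_edgeBall_le hb ℓ _)

/-- After numbering its vertices, a representative is described by at most `B` vertices,
multiplicities at most `D`, colors at most `k` and two root positions. There are finitely many such
codes, and equal codes give isomorphic graphs. -/
theorem finite_dbTypes (k ℓ D : ℕ) : Finite (dbTypes k ℓ D) := by
  classical
  choose H hT hb hℓ using fun T : dbTypes k ℓ D => T.2
  set B := 2 * (D + 1) ^ ℓ
  let η : ∀ T, Fin (H T).V.card ≃ {v // v ∈ (H T).V} := fun T => (H T).V.equivFin.symm
  let code : dbTypes k ℓ D → Σ b : Fin (B + 1), (Fin b → Fin b → Fin (D + 1)) ×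
      (Fin b → Fin (k + 1)) × (Fin b × Fin b) := fun T =>
    ⟨⟨(H T).V.card, Nat.lt_succ_of_le (DRGraph.card_V_le (hb T) (hℓ T))⟩,
      fun i j => ⟨(H T).E.count ((η T i).1, (η T j).1),
        Nat.lt_succ_of_le (((H T).count_le_degree _ _).trans (hb T _ (η T j).2))⟩,
      fun i => ⟨(H T).χ (η T i).1,
        Nat.lt_succ_of_le (Finset.mem_Icc.1 ((H T).color_mem _ (η T i).2)).2⟩,
      ((η T).symm ⟨(H T).root.1, (H T).mem_left _ (H T).root_mem⟩,
        (η T).symm ⟨(H T).root.2, (H T).mem_right _ (H T).root_mem⟩)⟩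
  -- The later components of a code have types that depend on the number of vertices. Stating the
  -- decoding for a code with free components lets this number be substituted, so that two
  -- numberings by the same `Fin b` can be compared.
  have key : ∀ (b : Fin (B + 1)) (c : Fin b → Fin b → Fin (D + 1)) (col : Fin b → Fin (k + 1))
      (r : Fin b × Fin b) (T : dbTypes k ℓ D), code T = ⟨b, c, col, r⟩ →
      ∃ ζ : Fin b ≃ {v // v ∈ (H T).V},
        (∀ i j, (H T).E.count ((ζ i).1, (ζ j).1) = c i j) ∧ (∀ i, (H T).χ (ζ i).1 = col i) ∧
        ζ.symm ⟨(H T).root.1, (H T).mem_left _ (H T).root_mem⟩ = r.1 ∧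
        ζ.symm ⟨(H T).root.2, (H T).mem_right _ (H T).root_mem⟩ = r.2 := by
    intro b c col r T h
    simp only [code, Sigma.mk.injEq] at h
    obtain ⟨rfl, h⟩ := h
    simp only [heq_eq_eq, Prod.mk.injEq] at h
    obtain ⟨rfl, rfl, rfl⟩ := h
    exact ⟨η T, fun _ _ => rfl, fun _ => rfl, rfl, rfl⟩
  refine Finite.of_injective code fun T T' h => Subtype.ext ?_
  obtain ⟨ζ, h1, h2, h3, h4⟩ := key _ _ _ _ T rfl
  obtain ⟨ζ', h1', h2', h3', h4'⟩ := key _ _ _ _ T' h.symm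
  rw [← hT T, ← hT T', DRGraph.type_eq_iff]
  exact DRGraph.iso_of_equiv ζ ζ' (fun i j => (h1 i j).trans (h1' i j).symm)
    (fun i => (h2 i).trans (h2' i).symm) (h3.trans h3'.symm) (h4.trans h4'.symm)

/-! ### Recognizing a type from recorded edges -/

/-- A recorded edge `(u, v)` with the colors of its endpoints. A loop `((v, v), (0, 0))` records the
sampled vertex `v`. -/
abbrev EdgeRec : Type := (ℕ × ℕ) × (ℕ × ℕ)

/-- The record of an edge. -/
def edgeRec (χ : ℕ → ℕ) (e : ℕ × ℕ) : EdgeRec := (e, (χ e.1, χ e.2))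

/-- A rooted colored multigraph on `Fin b` with some vertices marked as interior. -/
structure Pattern (b : ℕ) where
  mult : Fin b → Fin b → ℕ
  color : Fin b → ℕ
  interior : Fin b → Bool
  root : Fin b × Fin b

/-- `x` embeds the pattern into the recorded graph such that the neighbors of interior vertices lie
in the image. -/
structure Pattern.Matches {b : ℕ} (P : Pattern b) (E : List EdgeRec) (x : Fin b → ℕ) : Prop where
  inj : ∀ i j, x i = x j → i = j
  mult : ∀ i j, E.countP (fun q => q.1 = (x i, x j)) = P.mult i j
  left : ∀ q ∈ E, ∀ i, q.1.1 = x i → q.2.1 = P.color i ∧ (P.interior i → ∃ j, q.1.2 = x j)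
  right : ∀ q ∈ E, ∀ i, q.1.2 = x i → q.2.2 = P.color i ∧ (P.interior i → ∃ j, q.1.1 = x j)

open Classical in
/-- The pattern of a rooted graph: a vertex is interior if its distance from a root is less than
`ℓ`. -/
noncomputable def DRGraph.pattern {k b : ℕ} (H : DRGraph k) (ℓ : ℕ)
    (η : Fin b ≃ {v // v ∈ H.V}) : Pattern b where
  mult i j := H.E.count ((η i).1, (η j).1)
  color i := H.χ (η i).1
  interior i := decide (∃ L < ℓ, H.HasPath L H.root.1 (η i).1 ∨ H.HasPath L H.root.2 (η i).1)
  root := (η.symm ⟨H.root.1, H.mem_left _ H.root_mem⟩,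
    η.symm ⟨H.root.2, H.mem_right _ H.root_mem⟩)

/-- A root is adjacent to the other root, and any other vertex to its predecessor on a walk from a
root. Hence there are no isolated vertices, whose colors would not appear in any edge record. -/
theorem DRGraph.exists_adj {k ℓ : ℕ} {H : DRGraph k} {v : ℕ} (hv : v ∈ H.edgeBall ℓ H.root) :
    ∃ u, H.Adj v u := by
  obtain ⟨-, L, -, h⟩ := MGraph.mem_edgeBall.1 hv
  cases L with
  | zero =>
    rw [MGraph.hasPath_zero, MGraph.hasPath_zero] at h
    rcases h with rfl | rfl
    · exact ⟨H.root.2, .inl H.root_mem⟩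
    · exact ⟨H.root.1, .inr H.root_mem⟩
  | succ L =>
    rw [MGraph.hasPath_succ, MGraph.hasPath_succ] at h
    rcases h with ⟨z, -, hz⟩ | ⟨z, -, hz⟩ <;> exact ⟨z, hz.symm⟩

section Matching

variable {k b ℓ : ℕ} {G : ColoredGraph k} {σ : List (ℕ × ℕ)} {H : DRGraph k}
  {η : Fin b ≃ {v // v ∈ H.V}} {x : Fin b → ℕ} {e : ℕ × ℕ}

theorem countP_map_edgeRec (χ : ℕ → ℕ) (σ : List (ℕ × ℕ)) (e : ℕ × ℕ) :
    (σ.map (edgeRec χ)).countP (fun q => q.1 = e) = (σ : Multiset (ℕ × ℕ)).count e := by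
  rw [List.countP_map, Multiset.count, Multiset.coe_countP]
  refine List.countP_congr fun a _ => ?_
  exact decide_eq_true_iff.trans (eq_comm.trans decide_eq_true_iff.symm)

namespace Pattern.Matches

variable (hσ : (σ : Multiset (ℕ × ℕ)) = G.E)
  (hx : (H.pattern ℓ η).Matches (σ.map (edgeRec G.χ)) x)
include hσ hx

theorem count_eq (i j : Fin b) :
    H.E.count ((η i).1, (η j).1) = G.E.count (x i, x j) := by
  have := hx.mult i j
  rw [countP_map_edgeRec, hσ] at this
  exact this.symm

theorem adj_iff (i j : Fin b) : H.Adj (η i).1 (η j).1 ↔ G.Adj (x i) (x j) := by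
  simp only [MGraph.Adj, ← Multiset.one_le_count_iff_mem, hx.count_eq hσ]

theorem exists_of_adj {i : Fin b} (hi : (H.pattern ℓ η).interior i) {z : ℕ}
    (h : G.Adj (x i) z) : ∃ j, z = x j := by
  rcases h with h | h
  · have : edgeRec G.χ (x i, z) ∈ σ.map (edgeRec G.χ) :=
      List.mem_map_of_mem (by rwa [← hσ, Multiset.mem_coe] at h)
    exact (hx.left _ this i rfl).2 hi
  · have : edgeRec G.χ (z, x i) ∈ σ.map (edgeRec G.χ) :=
      List.mem_map_of_mem (by rwa [← hσ, Multiset.mem_coe] at h)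
    exact (hx.right _ this i rfl).2 hi

/-- A match constrains colors only through records of incident edges; this suffices because every
vertex of `H` has such an edge. -/
theorem color_eq (hH : ∀ v ∈ H.V, v ∈ H.edgeBall ℓ H.root) (i : Fin b) :
    H.χ (η i).1 = G.χ (x i) := by
  obtain ⟨u, hu⟩ := DRGraph.exists_adj (hH _ (η i).2)
  obtain ⟨j, hj⟩ := η.surjective ⟨u, hu.right_mem⟩
  have hu' : u = (η j).1 := by rw [hj]
  rw [hu', hx.adj_iff hσ] at hu
  rcases hu with h | h
  · have : edgeRec G.χ (x i, x j) ∈ σ.map (edgeRec G.χ) :=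
      List.mem_map_of_mem (by rwa [← hσ, Multiset.mem_coe] at h)
    exact (hx.left _ this i rfl).1.symm
  · have : edgeRec G.χ (x j, x i) ∈ σ.map (edgeRec G.χ) :=
      List.mem_map_of_mem (by rwa [← hσ, Multiset.mem_coe] at h)
    exact (hx.right _ this i rfl).1.symm

/-- Paths from a root in the pattern and in the graph correspond to each other. -/
theorem hasPath_iff {r : Fin b} (hr : ∀ L < ℓ, ∀ i, H.HasPath L (η r).1 (η i).1 →
      (H.pattern ℓ η).interior i) {L : ℕ} (hL : L ≤ ℓ) (z : ℕ) :
    G.HasPath L (x r) z ↔ ∃ i, z = x i ∧ H.HasPath L (η r).1 (η i).1 := by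
  induction L generalizing z with
  | zero =>
    simp only [MGraph.hasPath_zero]
    constructor
    · rintro rfl
      exact ⟨r, rfl, rfl⟩
    · rintro ⟨i, rfl, h⟩
      rw [η.injective (Subtype.ext h)]
  | succ L ih =>
    simp only [MGraph.hasPath_succ]
    constructor
    · rintro ⟨y, hy, hyz⟩
      obtain ⟨i, rfl, hi⟩ := (ih (by omega) y).1 hy
      -- The last vertex before the end is at distance less than `ℓ` from the root, hence interior,
      -- and its neighbors lie in the image.
      obtain ⟨j, rfl⟩ := hx.exists_of_adj hσ (hr L (by omega) i hi) hyz
      exact ⟨j, rfl, _, hi, (hx.adj_iff hσ i j).2 hyz⟩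
    · rintro ⟨i, rfl, y, hy, hyi⟩
      obtain ⟨j, hj⟩ := η.surjective ⟨y, hyi.left_mem⟩
      have hj' : y = (η j).1 := by rw [hj]
      subst hj'
      exact ⟨x j, (ih (by omega) _).2 ⟨j, rfl, hy⟩, (hx.adj_iff hσ j i).1 hyi⟩

/-- Walks of length at most `ℓ` from the roots correspond in `H` and `G`, and every vertex of `H` is
reached by one. So the image of a match is neither smaller nor larger than the ball. -/
theorem edgeBall_eq (hH : ∀ v ∈ H.V, v ∈ H.edgeBall ℓ H.root)
    (h1 : x (H.pattern ℓ η).root.1 = e.1) (h2 : x (H.pattern ℓ η).root.2 = e.2) (z : ℕ) :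
    z ∈ G.edgeBall ℓ e ↔ ∃ i, z = x i := by
  have e1 : (η (H.pattern ℓ η).root.1).1 = H.root.1 := by simp [DRGraph.pattern]
  have e2 : (η (H.pattern ℓ η).root.2).1 = H.root.2 := by simp [DRGraph.pattern]
  have p1 : ∀ L ≤ ℓ, ∀ z, G.HasPath L e.1 z ↔ ∃ i, z = x i ∧ H.HasPath L H.root.1 (η i).1 := by
    intro L hL z
    rw [← h1, ← e1]
    refine hx.hasPath_iff hσ (fun L hL i h => ?_) hL z
    simp only [DRGraph.pattern, decide_eq_true_eq]
    exact ⟨L, hL, .inl (e1 ▸ h)⟩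
  have p2 : ∀ L ≤ ℓ, ∀ z, G.HasPath L e.2 z ↔ ∃ i, z = x i ∧ H.HasPath L H.root.2 (η i).1 := by
    intro L hL z
    rw [← h2, ← e2]
    refine hx.hasPath_iff hσ (fun L hL i h => ?_) hL z
    simp only [DRGraph.pattern, decide_eq_true_eq]
    exact ⟨L, hL, .inr (e2 ▸ h)⟩
  rw [MGraph.mem_edgeBall]
  constructor
  · rintro ⟨-, L, hL, h | h⟩
    · obtain ⟨i, hi, -⟩ := (p1 L hL z).1 h
      exact ⟨i, hi⟩
    · obtain ⟨i, hi, -⟩ := (p2 L hL z).1 h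
      exact ⟨i, hi⟩
  · rintro ⟨i, rfl⟩
    have hi := hH _ (η i).2
    obtain ⟨-, L, hL, h⟩ := MGraph.mem_edgeBall.1 hi
    refine ⟨?_, L, hL, h.imp (fun h => (p1 L hL _).2 ⟨i, rfl, h⟩)
      fun h => (p2 L hL _).2 ⟨i, rfl, h⟩⟩
    obtain ⟨u, hu⟩ := DRGraph.exists_adj hi
    obtain ⟨j, hj⟩ := η.surjective ⟨u, hu.right_mem⟩
    have hu' : u = (η j).1 := by rw [hj]
    rw [hu', hx.adj_iff hσ] at hu
    exact hu.left_mem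

/-- Since the image of `x` is the whole ball, `x` is a bijection onto the vertices of the
neighborhood, and it preserves multiplicities, colors and roots. -/
theorem nbrType_eq (hH : ∀ v ∈ H.V, v ∈ H.edgeBall ℓ H.root) (he : e ∈ G.E)
    (h1 : x (H.pattern ℓ η).root.1 = e.1) (h2 : x (H.pattern ℓ η).root.2 = e.2) :
    G.nbrType ℓ e he = H.type := by
  have hball := hx.edgeBall_eq hσ hH h1 h2
  have hV : ∀ z, z ∈ (G.nbhd ℓ e he).V ↔ ∃ i, z = x i := fun z => by
    rw [ColoredGraph.nbhd_V, hball]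
  let ζ : Fin b ≃ {v // v ∈ (G.nbhd ℓ e he).V} :=
    Equiv.ofBijective (fun i => ⟨x i, (hV _).2 ⟨i, rfl⟩⟩)
      ⟨fun i j h => hx.inj i j (congrArg Subtype.val h),
        fun v => ((hV v.1).1 v.2).imp fun i hi => Subtype.ext hi.symm⟩
  refine (DRGraph.type_eq_iff.2 (DRGraph.iso_of_equiv η ζ (fun i j => ?_) (fun i => ?_)
    ?_ ?_)).symm
  · rw [hx.count_eq hσ]
    exact (G.count_induce ((hball _).2 ⟨i, rfl⟩) ((hball _).2 ⟨j, rfl⟩)).symm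
  · exact hx.color_eq hσ hH i
  · rw [Equiv.eq_symm_apply]
    exact Subtype.ext h1
  · rw [Equiv.eq_symm_apply]
    exact Subtype.ext h2

end Pattern.Matches

/-- The isomorphism from `H` onto the neighborhood gives the match. -/
theorem exists_matches_of_nbrType_eq (hσ : (σ : Multiset (ℕ × ℕ)) = G.E) (he : e ∈ G.E)
    (hT : G.nbrType ℓ e he = H.type) :
    ∃ x : Fin b → ℕ, (H.pattern ℓ η).Matches (σ.map (edgeRec G.χ)) x ∧
      x (H.pattern ℓ η).root.1 = e.1 ∧ x (H.pattern ℓ η).root.2 = e.2 := by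
  obtain ⟨φ, hc, hχ, h1, h2⟩ := DRGraph.type_eq_iff.1 hT.symm
  let x : Fin b → ℕ := fun i => (φ (η i)).1
  have hmem : ∀ i, x i ∈ G.edgeBall ℓ e := fun i => by
    rw [← G.nbhd_V ℓ e he]
    exact (φ (η i)).2
  have hcount : ∀ i j, G.E.count (x i, x j) = H.E.count ((η i).1, (η j).1) := fun i j => by
    rw [hc]
    exact (G.count_induce (hmem i) (hmem j)).symm
  have hadj : ∀ i j, H.Adj (η i).1 (η j).1 → G.Adj (x i) (x j) := fun i j => by
    simp only [MGraph.Adj, ← Multiset.one_le_count_iff_mem, hcount]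
    exact id
  have hpath : ∀ L r i, H.HasPath L (η r).1 (η i).1 → G.HasPath L (x r) (x i) := by
    intro L r i
    induction L generalizing i with
    | zero =>
      simp only [MGraph.hasPath_zero]
      intro h
      rw [η.injective (Subtype.ext h)]
    | succ L ih =>
      simp only [MGraph.hasPath_succ]
      rintro ⟨y, hy, hyi⟩
      obtain ⟨j, hj⟩ := η.surjective ⟨y, hyi.left_mem⟩
      have hj' : y = (η j).1 := by rw [hj]
      subst hj'
      exact ⟨x j, ih _ hy, hadj j i hyi⟩
  have hr1 : x (H.pattern ℓ η).root.1 = e.1 := by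
    simp only [x, DRGraph.pattern, Equiv.apply_symm_apply]
    exact h1
  have hr2 : x (H.pattern ℓ η).root.2 = e.2 := by
    simp only [x, DRGraph.pattern, Equiv.apply_symm_apply]
    exact h2
  have hint : ∀ i, (H.pattern ℓ η).interior i → ∀ z, G.Adj (x i) z → ∃ j, z = x j := by
    intro i hi z hz
    simp only [DRGraph.pattern, decide_eq_true_eq] at hi
    obtain ⟨L, hL, hi⟩ := hi
    -- This is where the strict inequality in the definition of interior is needed: one more step
    -- from an interior vertex still ends at distance at most `ℓ`.
    have hzmem : z ∈ G.edgeBall ℓ e := by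
      refine MGraph.mem_edgeBall.2 ⟨hz.right_mem, L + 1, hL, ?_⟩
      simp only [MGraph.hasPath_succ, ← hr1, ← hr2]
      refine hi.imp (fun h => ⟨x i, hpath _ _ _ ?_, hz⟩) fun h => ⟨x i, hpath _ _ _ ?_, hz⟩
      · simpa [DRGraph.pattern] using h
      · simpa [DRGraph.pattern] using h
    rw [← G.nbhd_V ℓ e he] at hzmem
    exact ⟨η.symm (φ.symm ⟨z, hzmem⟩), by simp [x]⟩
  refine ⟨x, ⟨fun i j h => η.injective (φ.injective (Subtype.ext h)), fun i j => ?_, ?_, ?_⟩,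
    hr1, hr2⟩
  · rw [countP_map_edgeRec, hσ, hcount]
    rfl
  · intro q hq i hi
    obtain ⟨f, hf, rfl⟩ := List.mem_map.1 hq
    rw [← Multiset.mem_coe, hσ] at hf
    refine ⟨?_, fun h => hint i h f.2 (hi ▸ .inl hf)⟩
    change G.χ f.1 = H.χ (η i).1
    rw [hχ, show f.1 = x i from hi]
    rfl
  · intro q hq i hi
    obtain ⟨f, hf, rfl⟩ := List.mem_map.1 hq
    rw [← Multiset.mem_coe, hσ] at hf
    refine ⟨?_, fun h => hint i h f.1 (hi ▸ .inr hf)⟩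
    change G.χ f.2 = H.χ (η i).1
    rw [hχ, show f.2 = x i from hi]
    rfl

/-- A pattern embeds at the edge `e` inside `L` if and only if `e` has the type of the pattern and
the ball around `e` is contained in `L`. -/
theorem exists_matches_iff (hσ : (σ : Multiset (ℕ × ℕ)) = G.E)
    (hH : ∀ v ∈ H.V, v ∈ H.edgeBall ℓ H.root) (he : e ∈ G.E) (L : List ℕ) :
    (∃ x : Fin b → ℕ, (∀ i, x i ∈ L) ∧ (H.pattern ℓ η).Matches (σ.map (edgeRec G.χ)) x ∧
      x (H.pattern ℓ η).root.1 = e.1 ∧ x (H.pattern ℓ η).root.2 = e.2) ↔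
    G.nbrType ℓ e he = H.type ∧ ∀ v ∈ G.edgeBall ℓ e, v ∈ L := by
  constructor
  · rintro ⟨x, hL, hx, h1, h2⟩
    refine ⟨hx.nbrType_eq hσ hH he h1 h2, fun v hv => ?_⟩
    obtain ⟨i, rfl⟩ := (hx.edgeBall_eq hσ hH h1 h2 v).1 hv
    exact hL i
  · rintro ⟨hT, hL⟩
    obtain ⟨x, hx, h1, h2⟩ := exists_matches_of_nbrType_eq (η := η) hσ he hT
    exact ⟨x, fun i => hL _ ((hx.edgeBall_eq hσ hH h1 h2 _).2 ⟨i, rfl⟩), hx, h1, h2⟩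

end Matching

/-- Whether a pattern embeds by `x` depends only on the recorded edges that meet its image. -/
theorem Pattern.matches_congr {b : ℕ} (P : Pattern b) {E E' : List EdgeRec} {L : List ℕ}
    (h : E.filter (fun q => q.1.1 ∈ L ∨ q.1.2 ∈ L) = E'.filter (fun q => q.1.1 ∈ L ∨ q.1.2 ∈ L))
    {x : Fin b → ℕ} (hx : ∀ i, x i ∈ L) (hP : P.Matches E x) : P.Matches E' x := by
  have hmem : ∀ q ∈ E', (q.1.1 ∈ L ∨ q.1.2 ∈ L) → q ∈ E := fun q hq hL => by
    have : q ∈ E'.filter (fun q => q.1.1 ∈ L ∨ q.1.2 ∈ L) := by simpa using ⟨hq, hL⟩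
    rw [← h] at this
    exact (List.mem_filter.1 this).1
  refine ⟨hP.inj, fun i j => ?_, fun q hq i hi => hP.left q (hmem q hq ?_) i hi,
    fun q hq i hi => hP.right q (hmem q hq ?_) i hi⟩
  · rw [← hP.mult i j]
    have key : ∀ F : List EdgeRec, F.countP (fun q => q.1 = (x i, x j)) =
        (F.filter (fun q => q.1.1 ∈ L ∨ q.1.2 ∈ L)).countP (fun q => q.1 = (x i, x j)) := by
      intro F
      rw [List.countP_filter]
      refine List.countP_congr fun q _ => ?_
      simp only [decide_eq_true_eq, Bool.and_eq_true]
      exact ⟨fun h => ⟨h, by rw [h]; exact .inl (hx i)⟩, fun h => h.1⟩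
    rw [key E', key E, h]
  · rw [hi]; exact .inl (hx i)
  · rw [hi]; exact .inr (hx i)

/-! ### Primitive recursive search for embeddings -/

section PrimrecTools

variable {α β : Type*} [Primcodable α] [Primcodable β]

theorem PrimrecPred.imp {p q : α → Prop} (hp : PrimrecPred p) (hq : PrimrecPred q) :
    PrimrecPred fun a => p a → q a :=
  (hp.not.or hq).of_eq fun _ => imp_iff_not_or.symm

theorem PrimrecPred.forall_mem {f : α → List β} {R : α → β → Prop} (hf : Primrec f)
    (hR : PrimrecPred fun s : α × β => R s.1 s.2) : PrimrecPred fun a => ∀ b ∈ f a, R a b :=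
  (PrimrecRel.forall_mem_list (R := fun b a => R a b)
    (hR.comp (Primrec.snd.pair Primrec.fst))).comp hf Primrec.id

theorem PrimrecPred.exists_mem {f : α → List β} {R : α → β → Prop} (hf : Primrec f)
    (hR : PrimrecPred fun s : α × β => R s.1 s.2) : PrimrecPred fun a => ∃ b ∈ f a, R a b :=
  (PrimrecRel.exists_mem_list (R := fun b a => R a b)
    (hR.comp (Primrec.snd.pair Primrec.fst))).comp hf Primrec.id

theorem PrimrecPred.mem {f : α → List β} {g : α → β} (hf : Primrec f) (hg : Primrec g) :
    PrimrecPred fun a => g a ∈ f a :=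
  (PrimrecPred.exists_mem (R := fun a b => b = g a) hf
    (Primrec.eq.comp Primrec.snd (hg.comp Primrec.fst))).of_eq fun a => by simp

theorem Primrec.list_filter {f : α → List β} {R : α → β → Prop} [∀ a, DecidablePred (R a)]
    (hf : Primrec f) (hR : PrimrecPred fun s : α × β => R s.1 s.2) :
    Primrec fun a => (f a).filter fun b => R a b :=
  (PrimrecRel.listFilter (R := fun b a => R a b)
    (hR.comp (Primrec.snd.pair Primrec.fst))).comp hf Primrec.id

theorem Primrec.list_countP {f : α → List β} {R : α → β → Prop} [∀ a, DecidablePred (R a)]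
    (hf : Primrec f) (hR : PrimrecPred fun s : α × β => R s.1 s.2) :
    Primrec fun a => (f a).countP fun b => R a b :=
  (Primrec.list_length.comp (Primrec.list_filter hf hR)).of_eq fun _ =>
    List.countP_eq_length_filter.symm

theorem Primrec.nat_pow' : Primrec₂ ((· ^ ·) : ℕ → ℕ → ℕ) :=
  Primrec₂.unpaired'.1 Nat.Primrec.pow

end PrimrecTools

/-- All assignments of elements of `L` to the elements of a list. -/
def assignments {ι : Type*} : List ι → List ℕ → List (List (ι × ℕ))
  | [], _ => [[]]
  | i :: vs, L => L.flatMap fun x => (assignments vs L).map fun a => (i, x) :: a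

/-- Distinctness of the entries of `vs` ensures that a list of choices comes from a function. -/
theorem mem_assignments {ι : Type*} {vs : List ι} (hvs : vs.Nodup) {L : List ℕ}
    {a : List (ι × ℕ)} :
    a ∈ assignments vs L ↔ ∃ x : ι → ℕ, (∀ i ∈ vs, x i ∈ L) ∧ a = vs.map fun i => (i, x i) := by
  classical
  induction vs generalizing a with
  | nil => simp [assignments]
  | cons i vs ih =>
    rw [List.nodup_cons] at hvs
    simp only [assignments, List.mem_flatMap, List.mem_map, ih hvs.2]
    constructor
    · rintro ⟨y, hy, _, ⟨x, hx, rfl⟩, rfl⟩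
      have hne : ∀ j ∈ vs, j ≠ i := fun j hj h => hvs.1 (h ▸ hj)
      refine ⟨Function.update x i y, ?_, ?_⟩
      · intro j hj
        rcases List.mem_cons.1 hj with rfl | hj
        · simpa using hy
        · simpa [hne j hj] using hx j hj
      · rw [List.map_cons, Function.update_self]
        congr 1
        exact List.map_congr_left fun j hj => by rw [Function.update_of_ne (hne j hj)]
    · rintro ⟨x, hx, rfl⟩
      exact ⟨x i, hx i List.mem_cons_self, _,
        ⟨x, fun j hj => hx j (List.mem_cons_of_mem _ hj), rfl⟩, rfl⟩

theorem primrec_assignments {ι : Type*} [Primcodable ι] (vs : List ι) :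
    Primrec (assignments vs) := by
  induction vs with
  | nil => exact Primrec.const _
  | cons i vs ih =>
    refine Primrec.list_flatMap Primrec.id ?_
    refine Primrec.list_map (ih.comp Primrec.fst) ?_
    exact Primrec.list_cons.comp
      ((Primrec.const i).pair (Primrec.snd.comp Primrec.fst)) Primrec.snd

namespace Pattern

variable {b : ℕ} (P : Pattern b)

/-- `Pattern.Matches` for an embedding given as a list. -/
structure ListMatches (E : List EdgeRec) (a : List (Fin b × ℕ)) : Prop where
  inj : ∀ p ∈ a, ∀ q ∈ a, p.2 = q.2 → p.1 = q.1
  mult : ∀ p ∈ a, ∀ q ∈ a, E.countP (fun t => t.1 = (p.2, q.2)) = P.mult p.1 q.1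
  left : ∀ q ∈ E, ∀ p ∈ a, q.1.1 = p.2 →
    q.2.1 = P.color p.1 ∧ (P.interior p.1 = true → ∃ s ∈ a, q.1.2 = s.2)
  right : ∀ q ∈ E, ∀ p ∈ a, q.1.2 = p.2 →
    q.2.2 = P.color p.1 ∧ (P.interior p.1 = true → ∃ s ∈ a, q.1.1 = s.2)

theorem listMatches_map_iff (E : List EdgeRec) (x : Fin b → ℕ) :
    P.ListMatches E ((List.finRange b).map fun i => (i, x i)) ↔ P.Matches E x := by
  constructor
  · rintro ⟨h1, h2, h3, h4⟩
    simp only [List.mem_finRange, List.mem_map, true_and, exists_exists_eq_and,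
      forall_exists_index, forall_apply_eq_imp_iff] at h1 h2 h3 h4
    exact ⟨h1, h2, h3, h4⟩
  · rintro ⟨h1, h2, h3, h4⟩
    constructor <;> simpa only [List.mem_finRange, List.mem_map, true_and,
      exists_exists_eq_and, forall_exists_index, forall_apply_eq_imp_iff]

open Primrec in
-- All quantifiers range over the given lists. The pattern is a constant of the program, so its
-- multiplicities, colors and markings are functions on finite types.
theorem primrecPred_listMatches :
    PrimrecPred fun s : List EdgeRec × List (Fin b × ℕ) => P.ListMatches s.1 s.2 := by
  have h1 : PrimrecPred fun s : List EdgeRec × List (Fin b × ℕ) =>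
      ∀ p ∈ s.2, ∀ q ∈ s.2, p.2 = q.2 → p.1 = q.1 := by
    refine .forall_mem snd (.forall_mem (snd.comp fst) (.imp ?_ ?_))
    · exact Primrec.eq.comp (snd.comp (snd.comp fst)) (snd.comp snd)
    · exact Primrec.eq.comp (fst.comp (snd.comp fst)) (fst.comp snd)
  have h2 : PrimrecPred fun s : List EdgeRec × List (Fin b × ℕ) =>
      ∀ p ∈ s.2, ∀ q ∈ s.2, s.1.countP (fun t => t.1 = (p.2, q.2)) = P.mult p.1 q.1 := by
    refine .forall_mem snd (.forall_mem (snd.comp fst) ?_)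
    refine Primrec.eq.comp (list_countP (fst.comp (fst.comp fst)) ?_) ?_
    · exact Primrec.eq.comp (fst.comp snd) ((snd.comp (snd.comp (fst.comp fst))).pair
        (snd.comp (snd.comp fst)))
    · exact (dom_finite fun p : Fin b × Fin b => P.mult p.1 p.2).comp
        ((fst.comp (snd.comp fst)).pair (fst.comp snd))
  have h3 : PrimrecPred fun s : List EdgeRec × List (Fin b × ℕ) =>
      ∀ q ∈ s.1, ∀ p ∈ s.2, q.1.1 = p.2 →
        q.2.1 = P.color p.1 ∧ (P.interior p.1 = true → ∃ r ∈ s.2, q.1.2 = r.2) := by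
    refine .forall_mem fst (.forall_mem (snd.comp fst) (.imp ?_ (.and ?_ (.imp ?_ ?_))))
    · exact Primrec.eq.comp (fst.comp (fst.comp (snd.comp fst))) (snd.comp snd)
    · exact Primrec.eq.comp (fst.comp (snd.comp (snd.comp fst)))
        ((dom_finite P.color).comp (fst.comp snd))
    · exact Primrec.eq.comp ((dom_finite P.interior).comp (fst.comp snd)) (const true)
    · refine .exists_mem (snd.comp (fst.comp fst)) ?_
      exact Primrec.eq.comp (snd.comp (fst.comp (snd.comp (fst.comp fst)))) (snd.comp snd)
  have h4 : PrimrecPred fun s : List EdgeRec × List (Fin b × ℕ) =>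
      ∀ q ∈ s.1, ∀ p ∈ s.2, q.1.2 = p.2 →
        q.2.2 = P.color p.1 ∧ (P.interior p.1 = true → ∃ r ∈ s.2, q.1.1 = r.2) := by
    refine .forall_mem fst (.forall_mem (snd.comp fst) (.imp ?_ (.and ?_ (.imp ?_ ?_))))
    · exact Primrec.eq.comp (snd.comp (fst.comp (snd.comp fst))) (snd.comp snd)
    · exact Primrec.eq.comp (snd.comp (snd.comp (snd.comp fst)))
        ((dom_finite P.color).comp (fst.comp snd))
    · exact Primrec.eq.comp ((dom_finite P.interior).comp (fst.comp snd)) (const true)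
    · refine .exists_mem (snd.comp (fst.comp fst)) ?_
      exact Primrec.eq.comp (fst.comp (fst.comp (snd.comp (fst.comp fst)))) (snd.comp snd)
  exact (((h1.and h2).and h3).and h4).of_eq fun s =>
    ⟨fun h => ⟨h.1.1.1, h.1.1.2, h.1.2, h.2⟩, fun h => ⟨⟨⟨h.1, h.2⟩, h.3⟩, h.4⟩⟩

/-- The pattern embeds with root edge `e` and with all vertices in `L`. -/
def EmbedsAt (E : List EdgeRec) (L : List ℕ) (e : ℕ × ℕ) : Prop :=
  ∃ x : Fin b → ℕ, (∀ i, x i ∈ L) ∧ P.Matches E x ∧ x P.root.1 = e.1 ∧ x P.root.2 = e.2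

open Classical in
/-- The number of recorded edges, with multiplicity, at which the pattern embeds within `L`. -/
noncomputable def embedCount (E : List EdgeRec) (L : List ℕ) : ℕ :=
  E.countP fun q => P.EmbedsAt E L q.1

/-- Replaces the quantifier over functions by a search in a finite list that is computed from `L`.
-/
theorem embedsAt_iff (E : List EdgeRec) (L : List ℕ) (e : ℕ × ℕ) :
    P.EmbedsAt E L e ↔ ∃ a ∈ assignments (List.finRange b) L,
      P.ListMatches E a ∧ (P.root.1, e.1) ∈ a ∧ (P.root.2, e.2) ∈ a := by
  simp only [mem_assignments (List.nodup_finRange b)]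
  constructor
  · rintro ⟨x, hL, hx, h1, h2⟩
    refine ⟨_, ⟨x, fun i _ => hL i, rfl⟩, (P.listMatches_map_iff E x).2 hx, ?_, ?_⟩
    · exact List.mem_map.2 ⟨_, List.mem_finRange _, by rw [h1]⟩
    · exact List.mem_map.2 ⟨_, List.mem_finRange _, by rw [h2]⟩
  · rintro ⟨_, ⟨x, hL, rfl⟩, hx, h1, h2⟩
    refine ⟨x, fun i => hL i (List.mem_finRange i), (P.listMatches_map_iff E x).1 hx, ?_, ?_⟩
    · obtain ⟨i, -, hi⟩ := List.mem_map.1 h1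
      obtain ⟨rfl, h⟩ := Prod.ext_iff.1 hi
      exact h
    · obtain ⟨i, -, hi⟩ := List.mem_map.1 h2
      obtain ⟨rfl, h⟩ := Prod.ext_iff.1 hi
      exact h

open Primrec in
theorem primrec_embedCount :
    Primrec fun s : List EdgeRec × List ℕ => P.embedCount s.1 s.2 := by
  classical
  refine list_countP (R := fun s q => P.EmbedsAt s.1 s.2 q.1) fst ?_
  refine PrimrecPred.of_eq (p := fun t : (List EdgeRec × List ℕ) × EdgeRec =>
    ∃ a ∈ assignments (List.finRange b) t.1.2,
      P.ListMatches t.1.1 a ∧ (P.root.1, t.2.1.1) ∈ a ∧ (P.root.2, t.2.1.2) ∈ a)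
    ?_ fun t => (P.embedsAt_iff _ _ _).symm
  refine .exists_mem ((primrec_assignments _).comp (snd.comp fst)) (.and ?_ (.and ?_ ?_))
  · exact P.primrecPred_listMatches.comp ((fst.comp (fst.comp fst)).pair snd)
  · exact .mem snd ((const _).pair (fst.comp (fst.comp (snd.comp fst))))
  · exact .mem snd ((const _).pair (snd.comp (fst.comp (snd.comp fst))))

end Pattern

/-! ### The sampling algorithm as a primitive recursive state machine -/

/-- The control part of the state: `((tosses, failed), (phase, edges read), (u, v), color of u)`. -/
abbrev Ctrl : Type := (ℕ × ℕ) × (ℕ × ℕ) × (ℕ × ℕ) × ℕ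

/-- The state of the sampling algorithm: `n`, the control part, the records. -/
abbrev SampState : Type := ℕ × Ctrl × List EdgeRec

/-- The record of a sampled vertex. -/
def loopRec (v : ℕ) : EdgeRec := ((v, v), (0, 0))

/-- Append a record unless the capacity is exhausted. -/
def pushRec (c : ℕ) (R : List EdgeRec) (q : EdgeRec) : List EdgeRec :=
  if R.length < c then R ++ [q] else R

/-- The parameters of the sampling algorithm, as functions of `n`: a vertex is sampled if `tosses`
coins show heads; the first `keep` edges and all edges that meet the sample are recorded; there are
at most `cap` records. -/
structure SampAlg where
  tosses : ℕ → ℕ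
  keep : ℕ → ℕ
  cap : ℕ → ℕ
  out : ℕ × ℕ × List EdgeRec → List ℕ
  primrec_tosses : Primrec tosses
  primrec_keep : Primrec keep
  primrec_cap : Primrec cap
  primrec_out : Primrec out

namespace SampState

/-- The memory contents that represent a state. -/
def enc (s : SampState) : List ℕ := s.1 :: Encodable.encode s.2.1 :: s.2.2.map Encodable.encode

/-- The state represented by the memory contents. -/
def dec (M : List ℕ) : SampState :=
  (M.getD 0 0, (Encodable.decode (M.getD 1 0)).getD default,
    (M.drop 2).map fun x => (Encodable.decode x).getD default)

theorem dec_enc (s : SampState) : dec (enc s) = s := by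
  obtain ⟨n, c, R⟩ := s
  have h : ((fun x => (Encodable.decode x : Option EdgeRec).getD default) ∘ Encodable.encode) = id :=
    funext fun q => by rw [Function.comp_apply, Encodable.encodek]; rfl
  simp only [dec, enc, List.getD_cons_zero, List.getD_cons_succ, Encodable.encodek,
    Option.getD_some, List.drop_succ_cons, List.drop_zero, List.map_map, h, List.map_id]

/-- The initial state. -/
def init (n : ℕ) : SampState := (n, ((0, 0), (0, 0), (0, 0), 0), [])

/-- The initial memory is not an encoded state, but its missing cells are read as default values,
and these give the initial state. -/
theorem dec_singleton (n : ℕ) : dec [n] = init n := by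
  simp [dec, init]

open Primrec in
theorem primrec_enc : Primrec enc :=
  list_cons.comp fst (list_cons.comp (Primrec.encode.comp (fst.comp snd))
    (list_map (snd.comp snd) (Primrec.encode.comp snd).to₂))

open Primrec in
theorem primrec_dec : Primrec dec := by
  refine ((list_getD 0).comp .id (const 0)).pair (Primrec.pair ?_ ?_)
  · exact option_getD_default.comp (Primrec.decode.comp ((list_getD 0).comp .id (const 1)))
  · exact list_map (list_drop.comp (const 2) .id)
      (option_getD_default.comp (Primrec.decode.comp snd)).to₂

end SampState

namespace SampAlg

variable (p : SampAlg)

/-- The next action in a state. -/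
def act (s : SampState) : StreamAction :=
  if s.2.1.1.1 < s.1 * p.tosses s.1 then .toss
  else if s.2.1.2.1.1 = 0 then .read
  else if s.2.1.2.1.1 = 1 then .query s.2.1.2.2.1.1
  else if s.2.1.2.1.1 = 2 then .query s.2.1.2.2.1.2
  else .output (p.out (s.1, s.2.1.2.1.2, s.2.2))

/-- Whether some coin of the current vertex has failed, including the one just seen. -/
def failed (s : SampState) (a : List ℕ) : ℕ := if a.getD 0 0 = 1 then s.2.1.1.2 else 1

/-- The new state after a coin toss. -/
def tossUpd (s : SampState) (a : List ℕ) : SampState :=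
  (s.1,
    ((s.2.1.1.1 + 1, if (s.2.1.1.1 + 1) % p.tosses s.1 = 0 then 0 else failed s a), s.2.1.2),
    if (s.2.1.1.1 + 1) % p.tosses s.1 = 0 ∧ failed s a = 0 then
      pushRec (p.cap s.1) s.2.2 (loopRec (s.2.1.1.1 / p.tosses s.1 + 1))
    else s.2.2)

/-- The new state after an edge or the end of the stream has been read. -/
def readUpd (s : SampState) (a : List ℕ) : SampState :=
  (s.1, (s.2.1.1, (if a = [] then 3 else 1, s.2.1.2.1.2), (a.getD 0 0, a.getD 1 0), 0), s.2.2)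

/-- The new state after the color of the first endpoint has been received. -/
def leftUpd (s : SampState) (a : List ℕ) : SampState :=
  (s.1, (s.2.1.1, (2, s.2.1.2.1.2), s.2.1.2.2.1, a.getD 0 0), s.2.2)

/-- The new state after the color of the second endpoint has been received. -/
def rightUpd (s : SampState) (a : List ℕ) : SampState :=
  (s.1, (s.2.1.1, (0, s.2.1.2.1.2 + 1), s.2.1.2.2.1, 0),
    if s.2.1.2.1.2 < p.keep s.1 ∨ loopRec s.2.1.2.2.1.1 ∈ s.2.2 ∨ loopRec s.2.1.2.2.1.2 ∈ s.2.2
    then pushRec (p.cap s.1) s.2.2 (s.2.1.2.2.1, (s.2.1.2.2.2, a.getD 0 0))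
    else s.2.2)

/-- The new state after an answer. -/
def upd (s : SampState) (a : List ℕ) : SampState :=
  if s.2.1.1.1 < s.1 * p.tosses s.1 then p.tossUpd s a
  else if s.2.1.2.1.1 = 0 then readUpd s a
  else if s.2.1.2.1.1 = 1 then leftUpd s a
  else p.rightUpd s a

open Primrec

theorem primrec_equiv_symm : Primrec StreamAction.equiv.symm := Primrec.of_equiv_symm

theorem primrec_query : Primrec StreamAction.query :=
  (primrec_equiv_symm.comp (sumInr.comp sumInl)).of_eq fun _ => rfl

theorem primrec_output : Primrec StreamAction.output :=
  (primrec_equiv_symm.comp (sumInr.comp sumInr)).of_eq fun _ => rfl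

theorem primrec_act : Primrec p.act := by
  have hc : Primrec fun s : SampState => s.2.1 := fst.comp snd
  have ht : PrimrecPred fun s : SampState => s.2.1.1.1 < s.1 * p.tosses s.1 :=
    nat_lt.comp (fst.comp (fst.comp hc)) (nat_mul.comp fst (p.primrec_tosses.comp fst))
  have hq : Primrec fun s : SampState => s.2.1.2.1.1 := fst.comp (fst.comp (snd.comp hc))
  have he : Primrec fun s : SampState => s.2.1.2.2.1 := fst.comp (snd.comp (snd.comp hc))
  refine ite ht (const _) (ite (Primrec.eq.comp hq (const 0)) (const _)
    (ite (Primrec.eq.comp hq (const 1)) ?_ (ite (Primrec.eq.comp hq (const 2)) ?_ ?_)))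
  · exact primrec_query.comp (fst.comp he)
  · exact primrec_query.comp (snd.comp he)
  · refine primrec_output.comp (p.primrec_out.comp ?_)
    exact fst.pair ((snd.comp (fst.comp (snd.comp hc))).pair (snd.comp snd))

theorem primrec_pushRec {α : Type*} [Primcodable α] {c : α → ℕ} {R : α → List EdgeRec}
    {q : α → EdgeRec} (hc : Primrec c) (hR : Primrec R) (hq : Primrec q) :
    Primrec fun a => pushRec (c a) (R a) (q a) :=
  ite (nat_lt.comp (list_length.comp hR) hc) (list_concat.comp hR hq) hR

theorem primrec_loopRec : Primrec loopRec := (Primrec.id.pair Primrec.id).pair (const _)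

theorem primrec_tossUpd : Primrec₂ p.tossUpd := by
  have hs : Primrec fun x : SampState × List ℕ => x.1 := fst
  have hn : Primrec fun x : SampState × List ℕ => x.1.1 := fst.comp hs
  have hc : Primrec fun x : SampState × List ℕ => x.1.2.1 := fst.comp (snd.comp hs)
  have hR : Primrec fun x : SampState × List ℕ => x.1.2.2 := snd.comp (snd.comp hs)
  have hi : Primrec fun x : SampState × List ℕ => x.1.2.1.1.1 := fst.comp (fst.comp hc)
  have hr : Primrec fun x : SampState × List ℕ => p.tosses x.1.1 := p.primrec_tosses.comp hn
  have hf : Primrec fun x : SampState × List ℕ => failed x.1 x.2 :=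
    ite (Primrec.eq.comp ((list_getD 0).comp snd (const 0)) (const 1))
      (snd.comp (fst.comp hc)) (const 1)
  have hm : PrimrecPred fun x : SampState × List ℕ => (x.1.2.1.1.1 + 1) % p.tosses x.1.1 = 0 :=
    Primrec.eq.comp (nat_mod.comp (succ.comp hi) hr) (const 0)
  refine hn.pair (Primrec.pair (Primrec.pair ((succ.comp hi).pair ?_) (snd.comp hc)) ?_)
  · exact ite hm (const 0) hf
  · refine ite (hm.and (Primrec.eq.comp hf (const 0))) ?_ hR
    exact primrec_pushRec (p.primrec_cap.comp hn) hR
      (primrec_loopRec.comp (succ.comp (nat_div.comp hi hr)))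

theorem primrec_readUpd : Primrec₂ readUpd := by
  have hs : Primrec fun x : SampState × List ℕ => x.1 := fst
  have hc : Primrec fun x : SampState × List ℕ => x.1.2.1 := fst.comp (snd.comp hs)
  refine (fst.comp hs).pair (Primrec.pair (Primrec.pair (fst.comp hc) (Primrec.pair (Primrec.pair
    ?_ ?_) (Primrec.pair (Primrec.pair ?_ ?_) (const 0)))) (snd.comp (snd.comp hs)))
  · exact ite (Primrec.eq.comp snd (const [])) (const 3) (const 1)
  · exact snd.comp (fst.comp (snd.comp hc))
  · exact (list_getD 0).comp snd (const 0)
  · exact (list_getD 0).comp snd (const 1)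

theorem primrec_leftUpd : Primrec₂ leftUpd := by
  have hs : Primrec fun x : SampState × List ℕ => x.1 := fst
  have hc : Primrec fun x : SampState × List ℕ => x.1.2.1 := fst.comp (snd.comp hs)
  refine (fst.comp hs).pair (Primrec.pair (Primrec.pair (fst.comp hc) (Primrec.pair (Primrec.pair
    (const 2) ?_) (Primrec.pair ?_ ?_))) (snd.comp (snd.comp hs)))
  · exact snd.comp (fst.comp (snd.comp hc))
  · exact fst.comp (snd.comp (snd.comp hc))
  · exact (list_getD 0).comp snd (const 0)

theorem primrec_rightUpd : Primrec₂ p.rightUpd := by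
  have hs : Primrec fun x : SampState × List ℕ => x.1 := fst
  have hn : Primrec fun x : SampState × List ℕ => x.1.1 := fst.comp hs
  have hc : Primrec fun x : SampState × List ℕ => x.1.2.1 := fst.comp (snd.comp hs)
  have hR : Primrec fun x : SampState × List ℕ => x.1.2.2 := snd.comp (snd.comp hs)
  have hm : Primrec fun x : SampState × List ℕ => x.1.2.1.2.1.2 :=
    snd.comp (fst.comp (snd.comp hc))
  have he : Primrec fun x : SampState × List ℕ => x.1.2.1.2.2.1 :=
    fst.comp (snd.comp (snd.comp hc))
  refine hn.pair (Primrec.pair (Primrec.pair (fst.comp hc) (Primrec.pair (Primrec.pair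
    (const 0) (succ.comp hm)) (he.pair (const 0)))) ?_)
  refine ite (.or ?_ (.or ?_ ?_)) ?_ hR
  · exact nat_lt.comp hm (p.primrec_keep.comp hn)
  · exact .mem hR (primrec_loopRec.comp (fst.comp he))
  · exact .mem hR (primrec_loopRec.comp (snd.comp he))
  · exact primrec_pushRec (p.primrec_cap.comp hn) hR
      (he.pair ((snd.comp (snd.comp (snd.comp hc))).pair ((list_getD 0).comp snd (const 0))))

theorem primrec_upd : Primrec₂ p.upd := by
  have hc : Primrec fun x : SampState × List ℕ => x.1.2.1 := fst.comp (snd.comp fst)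
  have hq : Primrec fun x : SampState × List ℕ => x.1.2.1.2.1.1 := fst.comp (fst.comp (snd.comp hc))
  have hn : Primrec fun x : SampState × List ℕ => x.1.1 := fst.comp fst
  exact ite (nat_lt.comp (fst.comp (fst.comp hc)) (nat_mul.comp hn (p.primrec_tosses.comp hn)))
    p.primrec_tossUpd (ite (Primrec.eq.comp hq (const 0)) primrec_readUpd
      (ite (Primrec.eq.comp hq (const 1)) primrec_leftUpd p.primrec_rightUpd))

/-- The sampling algorithm as a streaming algorithm. -/
def toStreamAlg : StreamAlg where
  action M := p.act (SampState.dec M)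
  update M a := SampState.enc (p.upd (SampState.dec M) a)
  action_computable := (p.primrec_act.comp SampState.primrec_dec).to_comp
  update_computable := (SampState.primrec_enc.comp
    (p.primrec_upd.comp (SampState.primrec_dec.comp fst) snd)).to_comp

/-- One step on states. -/
def stateStep (n : ℕ) (χ : ℕ → ℕ) (c : SampState × List (ℕ × ℕ)) (b : Bool) :
    SampState × List (ℕ × ℕ) :=
  match p.act c.1, c.2 with
  | .read, [] => (p.upd c.1 [], [])
  | .read, e :: σ => (p.upd c.1 [e.1, e.2], σ)
  | .query v, σ => (p.upd c.1 [if v ∈ Finset.Icc 1 n then χ v else 0], σ)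
  | .toss, σ => (p.upd c.1 [b.toNat], σ)
  | .output _, σ => (c.1, σ)

/-- Decoding turns steps on memory contents into steps on states. The second half allows for
unchanged memory, since the initial memory `[n]` is not of the form `enc s`; the space bound treats
this case separately. -/
theorem dec_step (n : ℕ) (χ : ℕ → ℕ) (M : List ℕ) (σ : List (ℕ × ℕ)) (b : Bool) :
    (SampState.dec (p.toStreamAlg.step n χ (M, σ) b).1, (p.toStreamAlg.step n χ (M, σ) b).2) =
        p.stateStep n χ (SampState.dec M, σ) b ∧
      ((p.toStreamAlg.step n χ (M, σ) b).1 = M ∨ ∃ s, (p.toStreamAlg.step n χ (M, σ) b).1 =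
        SampState.enc s) := by
  simp only [StreamAlg.step, stateStep, toStreamAlg]
  cases p.act (SampState.dec M) <;> cases σ <;>
    simp only [SampState.dec_enc, true_or, and_self, true_and] <;> exact .inr ⟨_, rfl⟩

theorem dec_foldl (n : ℕ) (χ : ℕ → ℕ) (coins : List Bool) (M : List ℕ) (σ : List (ℕ × ℕ)) :
    (SampState.dec (coins.foldl (p.toStreamAlg.step n χ) (M, σ)).1,
        (coins.foldl (p.toStreamAlg.step n χ) (M, σ)).2) =
      coins.foldl (p.stateStep n χ) (SampState.dec M, σ) ∧
      ((coins.foldl (p.toStreamAlg.step n χ) (M, σ)).1 = M ∨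
        ∃ s, (coins.foldl (p.toStreamAlg.step n χ) (M, σ)).1 = SampState.enc s) := by
  induction coins generalizing M σ with
  | nil => exact ⟨rfl, .inl rfl⟩
  | cons b coins ih =>
    obtain ⟨h1, h2⟩ := p.dec_step n χ M σ b
    obtain ⟨ih1, ih2⟩ := ih (p.toStreamAlg.step n χ (M, σ) b).1 (p.toStreamAlg.step n χ (M, σ) b).2
    simp only [List.foldl_cons, ← h1]
    refine ⟨ih1, ?_⟩
    rcases ih2 with h | h
    · rcases h2 with h' | ⟨s, h'⟩
      · exact .inl (h.trans h')
      · exact .inr ⟨s, h.trans h'⟩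
    · exact .inr h

/-- The state reached with the given coins. -/
def run (n : ℕ) (χ : ℕ → ℕ) (σ : List (ℕ × ℕ)) (coins : List Bool) : SampState × List (ℕ × ℕ) :=
  coins.foldl (p.stateStep n χ) (SampState.init n, σ)

theorem action_memory (n : ℕ) (χ : ℕ → ℕ) (σ : List (ℕ × ℕ)) (coins : List Bool) :
    p.toStreamAlg.action (p.toStreamAlg.memory n χ σ coins) = p.act (p.run n χ σ coins).1 := by
  have h := congrArg Prod.fst (p.dec_foldl n χ coins [n] σ).1
  rw [SampState.dec_singleton] at h
  exact congrArg p.act h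

theorem memory_eq (n : ℕ) (χ : ℕ → ℕ) (σ : List (ℕ × ℕ)) (coins : List Bool) :
    p.toStreamAlg.memory n χ σ coins = [n] ∨
      p.toStreamAlg.memory n χ σ coins = SampState.enc (p.run n χ σ coins).1 := by
  obtain ⟨h1, h2⟩ := p.dec_foldl n χ coins [n] σ
  refine h2.imp id ?_
  rintro ⟨s, hs⟩
  rw [SampState.dec_singleton] at h1
  have h := congrArg Prod.fst h1
  rw [StreamAlg.memory, run, ← h, hs, SampState.dec_enc]

end SampAlg

/-! ### What a run records -/

/-- The vertices among `1, …, m` all of whose `r` coins show heads. -/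
def headsVerts (r : ℕ) (f : ℕ → Bool) (m : ℕ) : List ℕ :=
  ((List.range m).filter fun v => ∀ j < r, f (v * r + j) = true).map (· + 1)

theorem mem_headsVerts {r m : ℕ} {f : ℕ → Bool} {v : ℕ} :
    v ∈ headsVerts r f m ↔ v ∈ Finset.Icc 1 m ∧ ∀ j < r, f ((v - 1) * r + j) = true := by
  simp only [headsVerts, List.mem_map, List.mem_filter, List.mem_range, decide_eq_true_eq,
    Finset.mem_Icc]
  constructor
  · rintro ⟨u, ⟨hu, h⟩, rfl⟩
    exact ⟨⟨by omega, hu⟩, h⟩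
  · rintro ⟨⟨h1, h2⟩, h⟩
    exact ⟨v - 1, ⟨by omega, h⟩, by omega⟩

theorem nodup_headsVerts (r : ℕ) (f : ℕ → Bool) (m : ℕ) : (headsVerts r f m).Nodup :=
  (List.nodup_range.filter _).map fun _ _ h => Nat.succ_injective h

theorem headsVerts_succ (r : ℕ) (f : ℕ → Bool) (m : ℕ) :
    headsVerts r f (m + 1) = headsVerts r f m ++
      if ∀ j < r, f (m * r + j) = true then [m + 1] else [] := by
  simp only [headsVerts, List.range_succ, List.filter_append, List.map_append]
  congr 1
  by_cases h : ∀ j < r, f (m * r + j) = true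
  · rw [if_pos h, List.filter_cons_of_pos (by simpa using h)]
    rfl
  · rw [if_neg h, List.filter_cons_of_neg (by simpa using h)]
    rfl

theorem length_headsVerts_le {r m n : ℕ} (f : ℕ → Bool) (h : m ≤ n) :
    (headsVerts r f m).length ≤ (headsVerts r f n).length := by
  obtain ⟨d, rfl⟩ := Nat.exists_eq_add_of_le h
  clear h
  induction d with
  | zero => exact le_rfl
  | succ d ih =>
    rw [← add_assoc, headsVerts_succ, List.length_append]
    omega

/-- The edges that are recorded after `m` edges have been read. -/
def recordedEdges (keep : ℕ) (S : List ℕ) (χ : ℕ → ℕ) : ℕ → List (ℕ × ℕ) → List EdgeRec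
  | _, [] => []
  | m, e :: σ =>
    (if m < keep ∨ e.1 ∈ S ∨ e.2 ∈ S then [edgeRec χ e] else []) ++
      recordedEdges keep S χ (m + 1) σ

namespace SampAlg

variable (p : SampAlg) {n : ℕ} {χ : ℕ → ℕ}

open Classical in
/-- The state after `i` coin tosses. -/
theorem run_toss (hr : 0 < p.tosses n) (f : ℕ → Bool) (σ : List (ℕ × ℕ)) (i : ℕ)
    (hi : i ≤ n * p.tosses n) :
    ∃ g R, ((List.range i).map f).foldl (p.stateStep n χ) (SampState.init n, σ) =
        ((n, ((i, g), (0, 0), (0, 0), 0), R), σ) ∧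
      ((headsVerts (p.tosses n) f n).length ≤ p.cap n →
        R = (headsVerts (p.tosses n) f (i / p.tosses n)).map loopRec ∧
        g = if ∀ j < i % p.tosses n, f (i / p.tosses n * p.tosses n + j) = true then 0 else 1) := by
  set r := p.tosses n with hrdef
  induction i with
  | zero => exact ⟨0, [], rfl, fun _ => by simp [headsVerts]⟩
  | succ i ih =>
    obtain ⟨g, R, h, hR⟩ := ih (by omega)
    have hact : p.act (n, ((i, g), (0, 0), (0, 0), 0), R) = .toss := by
      simp only [act]
      exact if_pos hi
    have hupd : ∀ a, p.upd (n, ((i, g), (0, 0), (0, 0), 0), R) a =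
        p.tossUpd (n, ((i, g), (0, 0), (0, 0), 0), R) a := fun a => by
      simp only [upd]
      exact if_pos hi
    rw [List.range_succ, List.map_append, List.foldl_append, h]
    simp only [List.map_cons, List.map_nil, List.foldl_cons, List.foldl_nil, stateStep, hact, hupd]
    refine ⟨_, _, rfl, fun hlen => ?_⟩
    obtain ⟨rfl, hg⟩ := hR hlen
    have hfail : failed (n, ((i, g), (0, 0), (0, 0), 0),
        (headsVerts r f (i / r)).map loopRec) [(f i).toNat] =
        if ∀ j < i % r + 1, f (i / r * r + j) = true then 0 else 1 := by
      have hfi : f (i / r * r + i % r) = f i := by rw [Nat.div_add_mod']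
      simp only [failed, List.getD_cons_zero, hg]
      simp only [Nat.forall_lt_succ_right, hfi]
      cases hf : f i
      · simp
      · simp
    simp only [hfail]
    have hdm := Nat.div_add_mod i r
    -- Toss `i` belongs to vertex `i / r + 1`. In this case it is the last of the `r` tosses of this
    -- vertex, which is now recorded or rejected, and the failure flag is reset.
    by_cases hm : (i + 1) % r = 0
    · have hir : i % r + 1 = r := by
        have := Nat.mod_lt i hr
        rcases Nat.lt_or_ge (i % r + 1) r with h' | h'
        · exfalso
          rw [Nat.add_mod, Nat.mod_eq_of_lt (show 1 < r by omega), Nat.mod_eq_of_lt h'] at hm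
          omega
        · omega
      have hdiv : (i + 1) / r = i / r + 1 := by
        rw [← hdm, add_assoc, hir, Nat.mul_add_div hr, Nat.div_self hr, Nat.mul_add_div hr,
          Nat.div_eq_of_lt (Nat.mod_lt i hr), add_zero]
      have hlt : i / r + 1 ≤ n := by
        have : r * (i / r + 1) ≤ r * n := by
          rw [mul_add, mul_one, mul_comm r n]
          omega
        exact Nat.le_of_mul_le_mul_left this hr
      simp only [← hrdef, hm, true_and, if_true, hir, hdiv, Nat.not_lt_zero, false_imp_iff,
        implies_true, and_true, headsVerts_succ, List.map_append]
      split_ifs with hall h1 h1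
      -- The sample so far is part of the whole sample, which fits by assumption, so the cap does
      -- not block this record.
      · have hl := length_headsVerts_le (r := r) f hlt
        rw [headsVerts_succ, if_pos hall, List.length_append, List.length_singleton] at hl
        rw [pushRec, if_pos (by rw [List.length_map]; omega)]
        rfl
      · exact absurd rfl h1
      · exact h1.elim
      · simp
    · have hir : (i + 1) % r = i % r + 1 := by
        have h1 := Nat.mod_lt i hr
        rcases Nat.lt_or_ge (i % r + 1) r with h' | h'
        · rw [Nat.add_mod, Nat.mod_eq_of_lt (show 1 < r by omega), Nat.mod_eq_of_lt h']
        · exfalso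
          apply hm
          have : i + 1 = r * (i / r + 1) := by
            rw [mul_add]
            omega
          rw [this, Nat.mul_mod_right]
      have hdiv : (i + 1) / r = i / r := by
        have h2 := Nat.div_add_mod (i + 1) r
        have : r * ((i + 1) / r) = r * (i / r) := by omega
        exact Nat.eq_of_mul_eq_mul_left hr this
      have hne : ¬ (i % r + 1 = 0) := Nat.succ_ne_zero _
      simp only [← hrdef, hir, hdiv, hne, false_and, if_false, true_and]

theorem act_read {i g m c : ℕ} {e : ℕ × ℕ} {R : List EdgeRec} (hi : n * p.tosses n ≤ i) :
    p.act (n, ((i, g), (0, m), e, c), R) = .read := by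
  simp [act, hi]

/-- The output after the whole stream has been read. -/
theorem run_read (σ : List (ℕ × ℕ)) (hσ : ∀ e ∈ σ, e.1 ∈ Finset.Icc 1 n ∧ e.2 ∈ Finset.Icc 1 n)
    {i : ℕ} (hi : n * p.tosses n ≤ i) (coins : List Bool) (hc : coins.length = 3 * σ.length + 1)
    (g m c : ℕ) (e : ℕ × ℕ) (R : List EdgeRec) :
    ∃ R', p.act (coins.foldl (p.stateStep n χ) ((n, ((i, g), (0, m), e, c), R), σ)).1 =
        .output (p.out (n, m + σ.length, R')) ∧
      ∀ S : List ℕ, (∀ v, loopRec v ∈ R ↔ v ∈ S) → (∀ e ∈ σ, e.1 ≠ e.2) →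
        R.length + (recordedEdges (p.keep n) S χ m σ).length ≤ p.cap n →
        R' = R ++ recordedEdges (p.keep n) S χ m σ := by
  induction σ generalizing coins m c e R with
  | nil =>
    obtain ⟨b, rfl⟩ := List.length_eq_one_iff.1 hc
    refine ⟨R, ?_, fun S _ _ _ => by simp [recordedEdges]⟩
    simp only [List.foldl_cons, List.foldl_nil, stateStep, p.act_read hi]
    simp [upd, readUpd, act, not_lt.2 hi]
  | cons a σ ih =>
    -- Each edge takes three steps, one reading and two color queries; their coins are ignored. The
    -- one extra step in `hc` reads the end of the stream.
    obtain ⟨b₁, b₂, b₃, coins, rfl⟩ : ∃ b₁ b₂ b₃ l, coins = b₁ :: b₂ :: b₃ :: l := by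
      match coins, hc with
      | b₁ :: b₂ :: b₃ :: l, _ => exact ⟨b₁, b₂, b₃, l, rfl⟩
      | [], h | [_], h | [_, _], h => simp at h
    obtain ⟨ha1, ha2⟩ := hσ a List.mem_cons_self
    have h3 : ∃ R₁, [b₁, b₂, b₃].foldl (p.stateStep n χ)
        ((n, ((i, g), (0, m), e, c), R), a :: σ) =
        ((n, ((i, g), (0, m + 1), a, 0), R₁), σ) ∧
        R₁ = if m < p.keep n ∨ loopRec a.1 ∈ R ∨ loopRec a.2 ∈ R then
          pushRec (p.cap n) R (edgeRec χ a) else R := by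
      refine ⟨_, ?_, rfl⟩
      have e1 : p.stateStep n χ ((n, ((i, g), (0, m), e, c), R), a :: σ) b₁ =
          ((n, ((i, g), (1, m), a, 0), R), σ) := by
        simp only [stateStep, p.act_read hi]
        simp [upd, readUpd, hi]
      have e2 : p.stateStep n χ ((n, ((i, g), (1, m), a, 0), R), σ) b₂ =
          ((n, ((i, g), (2, m), a, χ a.1), R), σ) := by
        have : p.act (n, ((i, g), (1, m), a, 0), R) = .query a.1 := by simp [act, hi]
        simp only [stateStep, this, if_pos ha1]
        simp [upd, leftUpd, hi]
      have e3 : p.stateStep n χ ((n, ((i, g), (2, m), a, χ a.1), R), σ) b₃ =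
          ((n, ((i, g), (0, m + 1), a, 0), if m < p.keep n ∨ loopRec a.1 ∈ R ∨ loopRec a.2 ∈ R then
            pushRec (p.cap n) R (edgeRec χ a) else R), σ) := by
        have : p.act (n, ((i, g), (2, m), a, χ a.1), R) = .query a.2 := by simp [act, hi]
        simp only [stateStep, this, if_pos ha2]
        simp [upd, rightUpd, hi, edgeRec]
      simp only [List.foldl_cons, List.foldl_nil, e1, e2, e3]
    obtain ⟨R₁, hstep, hR₁⟩ := h3
    obtain ⟨R', h1, h2⟩ := ih (fun e he => hσ e (List.mem_cons_of_mem _ he)) coins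
      (by simp only [List.length_cons] at hc; omega) (m + 1) 0 a R₁
    refine ⟨R', ?_, fun S hS hne hlen => ?_⟩
    · rw [show b₁ :: b₂ :: b₃ :: coins = [b₁, b₂, b₃] ++ coins from rfl, List.foldl_append,
        hstep, h1, List.length_cons]
      congr 4
      omega
    · simp only [recordedEdges, List.length_append] at hlen
      have hR₁' : R₁ = R ++ if m < p.keep n ∨ a.1 ∈ S ∨ a.2 ∈ S then [edgeRec χ a] else [] := by
        simp only [hS] at hR₁
        rw [hR₁]
        split_ifs at hlen ⊢
        · rw [pushRec, if_pos]
          simp only [List.length_singleton] at hlen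
          omega
        · simp
      rw [h2 S ?_ (fun e he => hne e (List.mem_cons_of_mem _ he)) ?_, hR₁', recordedEdges,
        List.append_assoc]
      · intro v
        rw [hR₁', List.mem_append, hS]
        -- The record of an edge is not a loop, so it cannot be mistaken for a sampled vertex.
        refine or_iff_left fun hv => ?_
        split_ifs at hv
        · rw [List.mem_singleton] at hv
          have h := congrArg Prod.fst hv
          exact hne a List.mem_cons_self (by rw [← (show (v, v) = a from h)])
        · simp at hv
      · rw [hR₁', List.length_append]
        omega

/-- After `n * tosses + 3 * |σ| + 1` steps the algorithm stops. If the sample and the recorded edges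
fit into the memory, the output is computed from them. -/
theorem act_run (hr : 0 < p.tosses n) (σ : List (ℕ × ℕ))
    (hσ : ∀ e ∈ σ, e.1 ∈ Finset.Icc 1 n ∧ e.2 ∈ Finset.Icc 1 n) (coins : List Bool)
    (hc : coins.length = n * p.tosses n + 3 * σ.length + 1) :
    ∃ R, p.act (p.run n χ σ coins).1 = .output (p.out (n, σ.length, R)) ∧
      ∀ S, S = headsVerts (p.tosses n) (fun j => coins.getD j false) n → (∀ e ∈ σ, e.1 ≠ e.2) →
        S.length + (recordedEdges (p.keep n) S χ 0 σ).length ≤ p.cap n →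
        R = S.map loopRec ++ recordedEdges (p.keep n) S χ 0 σ := by
  set f : ℕ → Bool := fun j => coins.getD j false with hf
  -- The first `n * tosses` coins decide the sample. The rest serve only as a clock for the pass.
  have hsplit : coins = (List.range (n * p.tosses n)).map f ++ coins.drop (n * p.tosses n) := by
    conv_lhs => rw [← List.take_append_drop (n * p.tosses n) coins]
    congr 1
    refine List.ext_getElem (by simp; omega) fun j h1 h2 => ?_
    simp only [List.length_map, List.length_range] at h2
    simp [hf, List.getD_eq_getElem?_getD, List.getElem?_eq_getElem (show j < coins.length by omega)]
  obtain ⟨g, R₀, h, hR₀⟩ := p.run_toss (χ := χ) hr f σ (n * p.tosses n) le_rfl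
  obtain ⟨R, h1, h2⟩ := p.run_read (χ := χ) σ hσ (i := n * p.tosses n) le_rfl
    (coins.drop (n * p.tosses n)) (by rw [List.length_drop]; omega) g 0 0 (0, 0) R₀
  refine ⟨R, ?_, ?_⟩
  · rw [run, hsplit, List.foldl_append, h, h1, zero_add]
  · rintro S rfl hne hlen
    have hR := (hR₀ (by omega)).1
    rw [Nat.mul_div_cancel _ hr] at hR
    rw [← hR]
    refine h2 _ (fun v => ?_) hne (by rw [hR, List.length_map]; exact hlen)
    rw [hR, List.mem_map]
    constructor
    · rintro ⟨u, hu, huv⟩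
      obtain rfl : u = v := congrArg (fun q : EdgeRec => q.1.1) huv
      exact hu
    · exact fun hv => ⟨v, hv, rfl⟩

end SampAlg

/-! ### Bounds on the state and on the memory -/

theorem length_pushRec_le {c : ℕ} {R : List EdgeRec} (q : EdgeRec) (h : R.length ≤ c) :
    (pushRec c R q).length ≤ c := by
  rw [pushRec]
  split_ifs with h'
  · rw [List.length_append, List.length_singleton]
    omega
  · exact h

theorem mem_pushRec {c : ℕ} {R : List EdgeRec} {q t : EdgeRec} (h : t ∈ pushRec c R q) :
    t ∈ R ∨ t = q := by
  rw [pushRec] at h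
  split_ifs at h
  · simpa using h
  · exact .inl h

namespace SampAlg

variable (p : SampAlg)

/-- All numbers in the state are at most `W` and the capacity is respected. -/
structure StateBound (n W m : ℕ) (c : SampState × List (ℕ × ℕ)) : Prop where
  fst : c.1.1 = n
  tosses : c.1.2.1.1.1 ≤ W
  failed : c.1.2.1.1.2 ≤ W
  phase : c.1.2.1.2.1.1 ≤ 3
  -- The last summand stands for an edge that has left the stream but has not been counted yet
  -- because its colors are still being queried.
  edges : c.1.2.1.2.1.2 + c.2.length +
    (if c.1.2.1.2.1.1 = 1 ∨ c.1.2.1.2.1.1 = 2 then 1 else 0) ≤ m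
  left : c.1.2.1.2.2.1.1 ≤ W
  right : c.1.2.1.2.2.1.2 ≤ W
  color : c.1.2.1.2.2.2 ≤ W
  recs : ∀ q ∈ c.1.2.2, (q.1.1 ≤ W ∧ q.1.2 ≤ W) ∧ q.2.1 ≤ W ∧ q.2.2 ≤ W
  length : c.1.2.2.length ≤ p.cap n
  stream : ∀ e ∈ c.2, e.1 ≤ W ∧ e.2 ≤ W

theorem StateBound.step {n W m : ℕ} {χ : ℕ → ℕ} (hW : n * p.tosses n ≤ W) (hn : n ≤ W)
    (h1 : 1 ≤ W) (hχ : ∀ v ∈ Finset.Icc 1 n, χ v ≤ W) {c : SampState × List (ℕ × ℕ)}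
    (h : p.StateBound n W m c) (b : Bool) : p.StateBound n W m (p.stateStep n χ c b) := by
  obtain ⟨⟨n', ⟨⟨i, g⟩, ⟨q, e⟩, ⟨u, v⟩, a⟩, R⟩, σ⟩ := c
  obtain ⟨a1, a2, a3, a4, a5, a6, a7, a8, a9, a10, a11⟩ := h
  simp only at a1 a2 a3 a4 a5 a6 a7 a8 a9 a10 a11
  subst a1
  have hχ' : ∀ v, (if v ∈ Finset.Icc 1 n' then χ v else 0) ≤ W := fun v => by
    split_ifs with hv
    · exact hχ v hv
    · exact Nat.zero_le _
  by_cases ht : i < n' * p.tosses n'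
  · have hfail : ∀ l, SampAlg.failed (n', ((i, g), (q, e), (u, v), a), R) l ≤ W := fun l => by
      simp only [SampAlg.failed]
      split_ifs <;> assumption
    have hact : p.act (n', ((i, g), (q, e), (u, v), a), R) = .toss := by simp [act, ht]
    have hr : 0 < p.tosses n' := Nat.pos_of_ne_zero fun h0 => by simp [h0] at ht
    -- The vertex being tossed for is at most `n'`, since `i` is less than `n' * p.tosses n'`.
    have hdiv : i / p.tosses n' + 1 ≤ W := by
      refine le_trans (Nat.succ_le_of_lt ?_) hn
      rwa [Nat.div_lt_iff_lt_mul hr]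
    simp only [stateStep, hact, upd, if_pos ht, tossUpd]
    refine ⟨rfl, ?_, ?_, a4, a5, a6, a7, a8, ?_, ?_, a11⟩
    · simp only
      omega
    · simp only
      split_ifs
      · exact Nat.zero_le _
      · exact hfail _
    · simp only
      split_ifs
      · intro t htm
        rcases mem_pushRec htm with h | rfl
        · exact a9 t h
        · exact ⟨⟨hdiv, hdiv⟩, Nat.zero_le _, Nat.zero_le _⟩
      · exact a9
    · simp only
      split_ifs
      · exact length_pushRec_le _ a10
      · exact a10
  · obtain rfl | rfl | rfl | rfl : q = 0 ∨ q = 1 ∨ q = 2 ∨ q = 3 := by omega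
    · have hact : p.act (n', ((i, g), (0, e), (u, v), a), R) = .read := by
        simp [act, not_lt.1 ht]
      cases σ with
      | nil =>
        simp only [stateStep, hact, upd, if_neg ht, if_true, readUpd]
        refine ⟨rfl, a2, a3, le_rfl, ?_, Nat.zero_le _, Nat.zero_le _, Nat.zero_le _, a9, a10, a11⟩
        simpa using a5
      | cons f σ =>
        simp only [stateStep, hact, upd, if_neg ht, if_true, readUpd]
        refine ⟨rfl, a2, a3, ?_, ?_, ?_, ?_, Nat.zero_le _, a9, a10,
          fun e he => a11 e (List.mem_cons_of_mem _ he)⟩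
        · simp
        · simp only [List.length_cons] at a5
          simp
          omega
        · exact (a11 f List.mem_cons_self).1
        · exact (a11 f List.mem_cons_self).2
    · have hact : p.act (n', ((i, g), (1, e), (u, v), a), R) = .query u := by
        simp [act, not_lt.1 ht]
      simp only [stateStep, hact, upd, if_neg ht, one_ne_zero, if_false, if_true, leftUpd]
      refine ⟨rfl, a2, a3, ?_, ?_, a6, a7, hχ' _, a9, a10, a11⟩
      · simp
      · simpa using a5
    · have hact : p.act (n', ((i, g), (2, e), (u, v), a), R) = .query v := by
        simp [act, not_lt.1 ht]
      simp only [stateStep, hact, upd, if_neg ht, two_ne_zero, if_false, OfNat.ofNat_ne_one,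
        rightUpd]
      have hv := hχ' v
      generalize (if v ∈ Finset.Icc 1 n' then χ v else 0) = x at hv ⊢
      refine ⟨rfl, a2, a3, Nat.zero_le _, ?_, a6, a7, Nat.zero_le _, ?_, ?_, a11⟩
      · simp at a5 ⊢
        omega
      · simp only
        split_ifs
        · intro t htm
          rcases mem_pushRec htm with h | rfl
          · exact a9 t h
          · exact ⟨⟨a6, a7⟩, a8, hv⟩
        · exact a9
      · simp only
        split_ifs
        · exact length_pushRec_le _ a10
        · exact a10
    · have hact : p.act (n', ((i, g), (3, e), (u, v), a), R) = .output (p.out (n', e, R)) := by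
        simp [act, not_lt.1 ht]
      simp only [stateStep, hact]
      exact ⟨rfl, a2, a3, a4, a5, a6, a7, a8, a9, a10, a11⟩

theorem stateBound_run {n W : ℕ} {χ : ℕ → ℕ} (hW : n * p.tosses n ≤ W) (hn : n ≤ W)
    (h1 : 1 ≤ W) (hχ : ∀ v ∈ Finset.Icc 1 n, χ v ≤ W) (σ : List (ℕ × ℕ))
    (hσ : ∀ e ∈ σ, e.1 ∈ Finset.Icc 1 n ∧ e.2 ∈ Finset.Icc 1 n) (coins : List Bool) :
    p.StateBound n W σ.length (p.run n χ σ coins) := by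
  rw [run]
  have h0 : p.StateBound n W σ.length (SampState.init n, σ) := by
    constructor <;> simp [SampState.init]
    intro a b hab
    have h := hσ _ hab
    simp only [Finset.mem_Icc] at h
    omega
  generalize (SampState.init n, σ) = c at h0
  induction coins generalizing c with
  | nil => exact h0
  | cons b coins ih => exact ih _ (h0.step p hW hn h1 hχ b)

/-- The pairing function is bounded by a square, so one level of pairing doubles the bound on the
number of bits. -/
theorem pair_lt_two_pow {a b w : ℕ} (ha : a < 2 ^ w) (hb : b < 2 ^ w) :
    Nat.pair a b < 2 ^ (2 * w) := by
  refine (Nat.pair_lt_max_add_one_sq a b).trans_le ?_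
  rw [mul_comm, pow_mul]
  exact Nat.pow_le_pow_left (Nat.succ_le_of_lt (max_lt ha hb)) 2

theorem sum_map_le_mul {α : Type*} (l : List α) (f : α → ℕ) {c : ℕ} (h : ∀ a ∈ l, f a ≤ c) :
    (l.map f).sum ≤ l.length * c := by
  induction l with
  | nil => simp
  | cons a l ih =>
    rw [List.map_cons, List.sum_cons, List.length_cons, add_mul, one_mul, add_comm]
    exact Nat.add_le_add (ih fun b hb => h b (List.mem_cons_of_mem _ hb)) (h a List.mem_cons_self)

theorem memBits_enc_le {n W m w : ℕ} {c : SampState × List (ℕ × ℕ)} (h : p.StateBound n W m c)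
    (hn : n ≤ W) (h3 : 3 ≤ W) (hm : m ≤ W) (hw : W < 2 ^ w) :
    memBits (SampState.enc c.1) ≤ (p.cap n + 2) * (16 * w + 1) := by
  obtain ⟨⟨n', ⟨⟨i, g⟩, ⟨q, e⟩, ⟨u, v⟩, a⟩, R⟩, σ⟩ := c
  obtain ⟨a1, a2, a3, a4, a5, a6, a7, a8, a9, a10, -⟩ := h
  simp only at a1 a2 a3 a4 a5 a6 a7 a8 a9 a10
  subst a1
  have hlt : ∀ x ≤ W, x < 2 ^ w := fun x hx => hx.trans_lt hw
  have mono : ∀ {x s t : ℕ}, x < 2 ^ s → s ≤ t → x < 2 ^ t := fun hx hst =>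
    hx.trans_le (Nat.pow_le_pow_right two_pos hst)
  -- The control part is nested four pairings deep, which gives the factor `16 = 2 ^ 4`. Records
  -- need only two levels.
  have hctrl : Encodable.encode (((i, g), (q, e), (u, v), a) : Ctrl) < 2 ^ (16 * w) := by
    have p1 := pair_lt_two_pow (hlt _ a2) (hlt _ a3)
    have p2 := pair_lt_two_pow (hlt _ (a4.trans h3)) (hlt e (by omega))
    have p3 := pair_lt_two_pow (hlt _ a6) (hlt _ a7)
    have p4 := pair_lt_two_pow p3 (mono (hlt _ a8) (show w ≤ 2 * w by omega))
    have p5 := pair_lt_two_pow (mono p2 (show 2 * w ≤ 2 * (2 * w) by omega)) p4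
    have p6 := pair_lt_two_pow (mono p1 (show 2 * w ≤ 2 * (2 * (2 * w)) by omega)) p5
    exact mono p6 (by omega)
  have hrec : ∀ t ∈ R, Nat.size (Encodable.encode t) + 1 ≤ 16 * w + 1 := by
    intro t ht
    obtain ⟨⟨h1, h2⟩, h3, h4⟩ := a9 t ht
    have p1 := pair_lt_two_pow (pair_lt_two_pow (hlt _ h1) (hlt _ h2))
      (pair_lt_two_pow (hlt _ h3) (hlt _ h4))
    exact Nat.succ_le_succ (Nat.size_le.2 (mono p1 (by omega)))
  have hs1 := Nat.size_le.2 hctrl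
  have hs2 := Nat.size_le.2 (mono (hlt _ hn) (show w ≤ 16 * w by omega))
  have hsum := sum_map_le_mul R (fun t => Nat.size (Encodable.encode t) + 1) hrec
  have hmul := Nat.mul_le_mul_right (16 * w + 1) a10
  simp only [memBits, SampState.enc, List.map_cons, List.sum_cons, List.map_map,
    Function.comp_def]
  rw [add_mul]
  omega

/-- The space bound. -/
theorem memBits_memory_le {n W w : ℕ} {χ : ℕ → ℕ} (hW : n * p.tosses n ≤ W) (hn : n ≤ W)
    (h3 : 3 ≤ W) (hχ : ∀ v ∈ Finset.Icc 1 n, χ v ≤ W) (σ : List (ℕ × ℕ))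
    (hσ : ∀ e ∈ σ, e.1 ∈ Finset.Icc 1 n ∧ e.2 ∈ Finset.Icc 1 n) (hm : σ.length ≤ W)
    (hw : W < 2 ^ w) (coins : List Bool) :
    memBits (p.toStreamAlg.memory n χ σ coins) ≤ (p.cap n + 2) * (16 * w + 1) := by
  rcases p.memory_eq n χ σ coins with h | h
  · rw [h]
    have h1 : Nat.size n ≤ w := Nat.size_le.2 (hn.trans_lt hw)
    simp only [memBits, List.map_cons, List.map_nil, List.sum_cons, List.sum_nil, add_zero]
    calc Nat.size n + 1 ≤ 1 * (16 * w + 1) := by omega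
      _ ≤ _ := Nat.mul_le_mul_right _ (by omega)
  · rw [h]
    exact p.memBits_enc_le (p.stateBound_run hW hn (by omega) hχ σ hσ coins) hn h3 hm hw

end SampAlg

/-! ### From records to estimates -/

theorem recordedEdges_eq_map {keep : ℕ} (S : List ℕ) (χ : ℕ → ℕ) {m : ℕ} {σ : List (ℕ × ℕ)}
    (h : m + σ.length ≤ keep) : recordedEdges keep S χ m σ = σ.map (edgeRec χ) := by
  induction σ generalizing m with
  | nil => rfl
  | cons e σ ih =>
    rw [List.length_cons] at h
    rw [recordedEdges, if_pos (.inl (by omega)), ih (by omega)]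
    rfl

/-- No edge that meets the sample is lost, and the additional edges among the first `keep` ones
disappear under the filter. -/
theorem filter_recordedEdges (keep : ℕ) (S : List ℕ) (χ : ℕ → ℕ) (m : ℕ) (σ : List (ℕ × ℕ)) :
    (recordedEdges keep S χ m σ).filter (fun q => q.1.1 ∈ S ∨ q.1.2 ∈ S) =
      (σ.map (edgeRec χ)).filter (fun q => q.1.1 ∈ S ∨ q.1.2 ∈ S) := by
  induction σ generalizing m with
  | nil => rfl
  | cons e σ ih =>
    rw [recordedEdges, List.filter_append, ih, List.map_cons]
    by_cases h : e.1 ∈ S ∨ e.2 ∈ S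
    · rw [if_pos (.inr h)]
      simp only [edgeRec, List.filter_cons, h, decide_true, if_true, List.filter_nil]
      rfl
    · simp only [List.filter_cons, edgeRec, h, decide_false, Bool.false_eq_true, if_false]
      split_ifs <;> simp [h]

theorem length_recordedEdges_le (keep : ℕ) (S : List ℕ) (χ : ℕ → ℕ) (m : ℕ)
    (σ : List (ℕ × ℕ)) : (recordedEdges keep S χ m σ).length ≤
      (keep - m) + σ.countP (fun e => e.1 ∈ S ∨ e.2 ∈ S) := by
  induction σ generalizing m with
  | nil => simp [recordedEdges]
  | cons e σ ih =>
    have := ih (m + 1)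
    rw [recordedEdges, List.length_append, List.countP_cons]
    by_cases h : e.1 ∈ S ∨ e.2 ∈ S
    · simp only [h, or_true, if_true, decide_true, List.length_singleton]
      omega
    · simp only [h, or_false, decide_false, Bool.false_eq_true, if_false]
      split_ifs
      · simp only [List.length_singleton]
        omega
      · simp only [List.length_nil]
        omega

theorem exists_of_mem_recordedEdges {keep : ℕ} {S : List ℕ} {χ : ℕ → ℕ} {m : ℕ}
    {σ : List (ℕ × ℕ)} {q : EdgeRec} (h : q ∈ recordedEdges keep S χ m σ) :
    q ∈ σ.map (edgeRec χ) := by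
  induction σ generalizing m with
  | nil => exact h
  | cons e σ ih =>
    rw [recordedEdges, List.mem_append] at h
    rw [List.map_cons, List.mem_cons]
    rcases h with h | h
    · left
      split_ifs at h
      · exact List.mem_singleton.1 h
      · simp at h
    · exact .inr (ih h)

namespace Pattern

variable {b : ℕ} (P : Pattern b)

/-- Both the matches inside `L` and the root edges that are counted depend only on records that meet
`L`. Hence the sampled records give the same count as the full stream. -/
theorem embedCount_congr {E E' : List EdgeRec} {L : List ℕ}
    (h : E.filter (fun q => q.1.1 ∈ L ∨ q.1.2 ∈ L) = E'.filter (fun q => q.1.1 ∈ L ∨ q.1.2 ∈ L)) :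
    P.embedCount E L = P.embedCount E' L := by
  classical
  have hiff : ∀ e, P.EmbedsAt E L e ↔ P.EmbedsAt E' L e := fun e =>
    ⟨fun ⟨x, hL, hx, h12⟩ => ⟨x, hL, P.matches_congr h hL hx, h12⟩,
      fun ⟨x, hL, hx, h12⟩ => ⟨x, hL, P.matches_congr h.symm hL hx, h12⟩⟩
  have key : ∀ F : List EdgeRec, F.countP (fun q => P.EmbedsAt E' L q.1) =
      (F.filter (fun q => q.1.1 ∈ L ∨ q.1.2 ∈ L)).countP (fun q => P.EmbedsAt E' L q.1) := by
    intro F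
    rw [List.countP_filter]
    refine List.countP_congr fun q _ => ?_
    simp only [decide_eq_true_eq, Bool.and_eq_true]
    refine ⟨fun hq => ⟨hq, ?_⟩, fun hq => hq.1⟩
    obtain ⟨x, hL, -, h1, -⟩ := hq
    exact .inl (h1 ▸ hL _)
  simp only [embedCount, hiff]
  rw [key E, key E', h]

end Pattern

theorem MGraph.exists_adj_of_mem_edgeBall {G : MGraph} {ℓ v : ℕ} {e : ℕ × ℕ} (he : e ∈ G.E)
    (hv : v ∈ G.edgeBall ℓ e) : ∃ u, G.Adj v u := by
  obtain ⟨-, L, -, h⟩ := MGraph.mem_edgeBall.1 hv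
  cases L with
  | zero =>
    rw [MGraph.hasPath_zero, MGraph.hasPath_zero] at h
    rcases h with rfl | rfl
    · exact ⟨e.2, .inl he⟩
    · exact ⟨e.1, .inr he⟩
  | succ L =>
    rw [MGraph.hasPath_succ, MGraph.hasPath_succ] at h
    rcases h with ⟨z, -, hz⟩ | ⟨z, -, hz⟩ <;> exact ⟨z, hz.symm⟩

namespace ColoredGraph

variable {k : ℕ} (G : ColoredGraph k)

/-- The edge `e` of `G` has the given neighborhood type. -/
def HasType (ℓ : ℕ) (T : EdgeType k) (e : ℕ × ℕ) : Prop := ∃ he : e ∈ G.E, G.nbrType ℓ e he = T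

open Classical in
/-- The number of edges of `G` with the given neighborhood type. -/
noncomputable def typeCount (ℓ : ℕ) (T : EdgeType k) : ℕ := G.E.countP (G.HasType ℓ T)

theorem edgeDist_eq (ℓ : ℕ) (T : EdgeType k) :
    G.edgeDist ℓ T = G.typeCount ℓ T / (Multiset.card G.E : ℝ) := by
  unfold edgeDist typeCount HasType
  congr

open Classical in
-- Translates the computed number into graph terms by applying `exists_matches_iff` to each edge.
theorem embedCount_pattern {ℓ b : ℕ} {σ : List (ℕ × ℕ)} (hσ : (σ : Multiset (ℕ × ℕ)) = G.E)
    {H : DRGraph k} (η : Fin b ≃ {v // v ∈ H.V}) (hH : ∀ v ∈ H.V, v ∈ H.edgeBall ℓ H.root)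
    (L : List ℕ) :
    (H.pattern ℓ η).embedCount (σ.map (edgeRec G.χ)) L =
      σ.countP fun e => G.HasType ℓ H.type e ∧ ∀ v ∈ G.edgeBall ℓ e, v ∈ L := by
  rw [Pattern.embedCount, List.countP_map]
  refine List.countP_congr fun e he => ?_
  rw [← Multiset.mem_coe, hσ] at he
  refine decide_eq_true_iff.trans (Iff.trans ?_ decide_eq_true_iff.symm)
  refine (exists_matches_iff hσ hH he L).trans (and_congr_left fun _ => ?_)
  exact ⟨fun h => ⟨he, h⟩, fun ⟨_, h⟩ => h⟩

theorem card_edgeBall_of_hasType {ℓ : ℕ} {H : DRGraph k} {e : ℕ × ℕ}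
    (h : G.HasType ℓ H.type e) : (G.edgeBall ℓ e).card = H.V.card := by
  obtain ⟨he, h⟩ := h
  rw [← G.nbhd_V ℓ e he]
  exact DRGraph.card_eq_of_iso (DRGraph.type_eq_iff.1 h)

theorem sum_typeCount {D ℓ N : ℕ} (hG : G.IsBounded D) (enum : Fin N ≃ dbTypes k ℓ D) :
    ∑ i, G.typeCount ℓ (enum i) = Multiset.card G.E := by
  classical
  -- The induction runs over submultisets with `G` fixed, because the types of edges would change if
  -- edges were removed from `G` itself. Each edge contributes to exactly one type.
  have key : ∀ F : Multiset (ℕ × ℕ), F ≤ G.E →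
      ∑ i, F.countP (G.HasType ℓ (enum i)) = Multiset.card F := by
    intro F
    induction F using Multiset.induction_on with
    | empty => simp
    | cons a F ih =>
      intro hF
      have ha : a ∈ G.E := Multiset.mem_of_le hF (Multiset.mem_cons_self a F)
      simp only [Multiset.countP_cons, Finset.sum_add_distrib, Multiset.card_cons]
      rw [ih ((Multiset.le_cons_self F a).trans hF)]
      congr 1
      obtain ⟨i, hi⟩ := enum.surjective ⟨_, G.nbrType_mem_dbTypes hG ℓ a ha⟩
      rw [Finset.sum_eq_single i]
      · rw [if_pos ⟨ha, by rw [hi]⟩]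
      · rintro j - hj
        refine if_neg ?_
        rintro ⟨_, h⟩
        exact hj (enum.injective (Subtype.ext (by rw [hi, ← h])))
      · exact fun h => absurd (Finset.mem_univ i) h
  exact key _ le_rfl

end ColoredGraph

/-- The endpoints of recorded edges. -/
def endpoints (E : List EdgeRec) : List ℕ := E.flatMap fun q => [q.1.1, q.1.2]

/-- The vertices recorded as sampled. -/
def sampleOf (R : List EdgeRec) : List ℕ := (R.filter fun q => q.1.1 = q.1.2).map fun q => q.1.1

/-- The recorded edges. -/
def edgesOf (R : List EdgeRec) : List EdgeRec := R.filter fun q => ¬ q.1.1 = q.1.2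

/-- Estimate of the number of edges with a given pattern from `s = (n, m, R)`. -/
noncomputable def estimate (r keep : ℕ → ℕ) {b : ℕ} (P : Pattern b)
    (s : ℕ × ℕ × List EdgeRec) : ℕ :=
  if s.2.1 ≤ keep s.1 then P.embedCount (edgesOf s.2.2) (endpoints (edgesOf s.2.2))
  else P.embedCount (edgesOf s.2.2) (sampleOf s.2.2) * 2 ^ (r s.1 * b)

open Primrec in
theorem primrec_estimate {r keep : ℕ → ℕ} (hr : Primrec r) (hk : Primrec keep) {b : ℕ}
    (P : Pattern b) : Primrec (estimate r keep P) := by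
  have hE : Primrec edgesOf := list_filter (f := fun l : List EdgeRec => l) (R := fun _ q => ¬ q.1.1 = q.1.2) .id
    (.not (Primrec.eq.comp (fst.comp (fst.comp snd)) (snd.comp (fst.comp snd))))
  have hS : Primrec sampleOf := list_map (list_filter (f := fun l : List EdgeRec => l) (R := fun _ q => q.1.1 = q.1.2) .id
    (Primrec.eq.comp (fst.comp (fst.comp snd)) (snd.comp (fst.comp snd))))
    (fst.comp (fst.comp snd)).to₂
  have hV : Primrec endpoints := list_flatMap (f := fun l : List EdgeRec => l) .id (list_cons.comp (fst.comp (fst.comp snd))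
    (list_cons.comp (snd.comp (fst.comp snd)) (const []))).to₂
  have hR : Primrec fun s : ℕ × ℕ × List EdgeRec => s.2.2 := snd.comp snd
  refine ite (nat_le.comp (fst.comp snd) (hk.comp fst)) ?_ (nat_mul.comp ?_ ?_)
  · exact P.primrec_embedCount.comp ((hE.comp hR).pair (hV.comp (hE.comp hR)))
  · exact P.primrec_embedCount.comp ((hE.comp hR).pair (hS.comp hR))
  · exact nat_pow'.comp (const 2) (nat_mul.comp (hr.comp fst) (const b))

section Estimate

variable {S : List ℕ} {E : List EdgeRec}

theorem edgesOf_append (hE : ∀ q ∈ E, q.1.1 ≠ q.1.2) : edgesOf (S.map loopRec ++ E) = E := by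
  rw [edgesOf, List.filter_append, List.filter_eq_nil_iff.2, List.nil_append,
    List.filter_eq_self]
  · simpa using hE
  · simp [loopRec]

theorem sampleOf_append (hE : ∀ q ∈ E, q.1.1 ≠ q.1.2) : sampleOf (S.map loopRec ++ E) = S := by
  rw [sampleOf, List.filter_append, List.filter_eq_self.2, List.filter_eq_nil_iff.2,
    List.append_nil, List.map_map]
  · exact List.map_id S
  · simpa using hE
  · simp [loopRec]

end Estimate

section EstimateGraph

variable {k ℓ b : ℕ} {G : ColoredGraph k} {σ : List (ℕ × ℕ)} {H : DRGraph k}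
  {r keep : ℕ → ℕ} (hσ : (σ : Multiset (ℕ × ℕ)) = G.E)
  (η : Fin b ≃ {v // v ∈ H.V}) (hH : ∀ v ∈ H.V, v ∈ H.edgeBall ℓ H.root)
  (n : ℕ) (S : List ℕ)
include hσ

theorem ne_of_mem_recordedEdges {K : ℕ} {q : EdgeRec} (h : q ∈ recordedEdges K S G.χ 0 σ) :
    q.1.1 ≠ q.1.2 := by
  obtain ⟨e, he, rfl⟩ := List.mem_map.1 (exists_of_mem_recordedEdges h)
  exact G.loopless e (by rwa [← Multiset.mem_coe, hσ] at he)

include hH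

/-- A short stream is recorded completely, and the estimate is exact. -/
theorem estimate_short (h : σ.length ≤ keep n) :
    estimate r keep (H.pattern ℓ η)
        (n, σ.length, S.map loopRec ++ recordedEdges (keep n) S G.χ 0 σ) =
      G.typeCount ℓ H.type := by
  classical
  rw [estimate, if_pos h, edgesOf_append fun q hq => ne_of_mem_recordedEdges hσ S hq,
    recordedEdges_eq_map S G.χ (by omega), G.embedCount_pattern hσ η hH,
    ColoredGraph.typeCount, ← hσ, Multiset.coe_countP]
  refine List.countP_congr fun e _ => ?_
  simp only [decide_eq_true_eq, and_iff_left_iff_imp]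
  rintro ⟨he, -⟩ v hv
  -- Every vertex of the ball has an incident edge, so it is among the endpoints of the recorded
  -- edges and the restriction to these is harmless.
  obtain ⟨u, hu⟩ := MGraph.exists_adj_of_mem_edgeBall he hv
  simp only [endpoints, List.mem_flatMap, List.mem_map, exists_exists_and_eq_and]
  rcases hu with hu | hu
  · exact ⟨(v, u), by rwa [← hσ, Multiset.mem_coe] at hu, by simp [edgeRec]⟩
  · exact ⟨(u, v), by rwa [← hσ, Multiset.mem_coe] at hu, by simp [edgeRec]⟩

open Classical in
/-- For a long stream the estimate is the number of edges of the given type whose ball has been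
sampled, divided by the probability of this event. -/
theorem estimate_long (h : ¬ σ.length ≤ keep n) :
    estimate r keep (H.pattern ℓ η)
        (n, σ.length, S.map loopRec ++ recordedEdges (keep n) S G.χ 0 σ) =
      (σ.countP fun e => G.HasType ℓ H.type e ∧ ∀ v ∈ G.edgeBall ℓ e, v ∈ S) *
        2 ^ (r n * b) := by
  have hne := fun q hq => ne_of_mem_recordedEdges (K := keep n) (q := q) hσ S hq
  rw [estimate, if_neg h]
  simp only [edgesOf_append hne, sampleOf_append hne]
  rw [← G.embedCount_pattern hσ η hH, Pattern.embedCount_congr]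
  exact filter_recordedEdges _ _ _ _ _

end EstimateGraph

/-! ### Coin counts and second moments -/

open Finset in
/-- The number of coin sequences that show heads in given positions. -/
theorem card_forall_mem_eq_true {ι : Type*} [Fintype ι] [DecidableEq ι] (P : Finset ι) :
    (univ.filter fun ω : ι → Bool => ∀ i ∈ P, ω i = true).card * 2 ^ P.card
      = 2 ^ Fintype.card ι := by
  have h : (univ.filter fun ω : ι → Bool => ∀ i ∈ P, ω i = true) =
      Fintype.piFinset fun i => if i ∈ P then {true} else univ := by
    ext ω
    simp only [mem_filter, mem_univ, true_and, Fintype.mem_piFinset]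
    refine forall_congr' fun i => ?_
    split_ifs with hi <;> simp [hi]
  rw [h, Fintype.card_piFinset]
  have h2 : ∀ i, (if i ∈ P then ({true} : Finset Bool) else univ).card =
      if i ∈ P then 1 else 2 := fun i => by split_ifs <;> simp
  simp only [h2, prod_ite, prod_const, one_pow, one_mul]
  rw [← pow_add]
  congr 1
  have := card_filter_add_card_filter_not (s := (univ : Finset ι)) (fun i => i ∈ P)
  rw [Finset.filter_mem_eq_inter, univ_inter, card_univ] at this
  omega

open Finset in
/-- The positions of the coins of the vertices in `A`. -/
theorem exists_positions {t r n : ℕ} (ht : n * r ≤ t) {A : Finset ℕ} (hA : A ⊆ Icc 1 n) :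
    ∃ P : Finset (Fin t), P.card = r * A.card ∧
      ∀ f : ℕ → Bool, (∀ i ∈ P, f i = true) ↔ ∀ v ∈ A, v ∈ headsVerts r f n := by
  refine ⟨(A ×ˢ range r).attach.image fun x => ⟨(x.1.1 - 1) * r + x.1.2, ?_⟩, ?_, fun f => ?_⟩
  · have h := mem_product.1 x.2
    have h1 := mem_Icc.1 (hA h.1)
    have h2 := mem_range.1 h.2
    have : (x.1.1 - 1 + 1) * r ≤ n * r := Nat.mul_le_mul_right _ (by omega)
    rw [add_mul, one_mul] at this
    omega
  · rw [card_image_of_injective, card_attach, card_product, card_range, mul_comm]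
    rintro ⟨⟨u, i⟩, hu⟩ ⟨⟨v, j⟩, hv⟩ h
    have hu' := mem_product.1 hu
    have hv' := mem_product.1 hv
    simp only [mem_range] at hu' hv'
    have hu1 := mem_Icc.1 (hA hu'.1)
    have hv1 := mem_Icc.1 (hA hv'.1)
    have h : (u - 1) * r + i = (v - 1) * r + j := congrArg Fin.val h
    have hr : 0 < r := by omega
    -- Vertices own disjoint blocks of `r` coins, so quotient and remainder modulo `r` recover the
    -- vertex and the coin. This gives independence.
    have e1 : u - 1 = v - 1 := by
      have h1 := congrArg (· / r) h
      simp only [mul_comm _ r, Nat.mul_add_div hr, Nat.div_eq_of_lt hu'.2,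
        Nat.div_eq_of_lt hv'.2] at h1
      omega
    have e2 : i = j := by rw [e1] at h; omega
    have e3 : u = v := by omega
    subst e2 e3
    rfl
  · simp only [mem_image, mem_attach, true_and, forall_exists_index, mem_headsVerts]
    constructor
    · exact fun h v hv => ⟨hA hv, fun j hj => h _ ⟨(v, j), mem_product.2 ⟨hv, mem_range.2 hj⟩⟩ rfl⟩
    · rintro h _ ⟨⟨v, j⟩, hx⟩ rfl
      exact (h v (mem_product.1 hx).1).2 j (mem_range.1 (mem_product.1 hx).2)

open Finset in
/-- The probability that all vertices of `A` are sampled. -/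
theorem card_subset_headsVerts {t r n : ℕ} (ht : n * r ≤ t) {A : Finset ℕ} (hA : A ⊆ Icc 1 n) :
    ((univ.filter fun ω : Fin t → Bool =>
      ∀ v ∈ A, v ∈ headsVerts r (fun j => (List.ofFn ω).getD j false) n).card : ℝ)
      = ((1 / 2) ^ r) ^ A.card * Fintype.card (Fin t → Bool) := by
  obtain ⟨P, hP, h⟩ := exists_positions ht hA
  have key := card_forall_mem_eq_true P
  rw [hP, Fintype.card_fin] at key
  have e : (univ.filter fun ω : Fin t → Bool =>
      ∀ v ∈ A, v ∈ headsVerts r (fun j => (List.ofFn ω).getD j false) n) =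
      univ.filter fun ω : Fin t → Bool => ∀ i ∈ P, ω i = true := by
    refine filter_congr fun ω _ => ?_
    rw [← h]
    refine forall₂_congr fun i _ => ?_
    simp [List.getD_eq_getElem?_getD]
  rw [e, Fintype.card_fun, Fintype.card_bool, Fintype.card_fin, ← key, ← pow_mul]
  push_cast
  rw [mul_comm, mul_assoc, ← mul_pow]
  norm_num
  congr!

open Finset in
/-- Chebyshev's inequality for the number of sampled sets, if each element is sampled
independently with probability `q`. -/
theorem card_deviation_le {Ω ι : Type*} [Fintype Ω] [DecidableEq Ω] (S : Ω → ℕ → Prop)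
    [∀ ω, DecidablePred (S ω)] (V : Finset ℕ) (q : ℝ) (hq : 0 ≤ q) (hq1 : q ≤ 1)
    (hS : ∀ A ⊆ V, ((univ.filter fun ω => ∀ v ∈ A, S ω v).card : ℝ) = q ^ A.card * Fintype.card Ω)
    (J : Finset ι) (A : ι → Finset ℕ) (b M : ℕ) (hA : ∀ j ∈ J, A j ⊆ V)
    (hb : ∀ j ∈ J, (A j).card = b)
    (hM : ∑ i ∈ J, (J.filter fun j => ¬ Disjoint (A i) (A j)).card ≤ M) {a : ℝ} (ha : 0 < a) :
    ((univ.filter fun ω => a ≤ |((J.filter fun j => ∀ v ∈ A j, S ω v).card : ℝ) - J.card * q ^ b|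
      ).card : ℝ) * a ^ 2 ≤ M * q ^ b * Fintype.card Ω := by
  set X : Ω → ℝ := fun ω => ((J.filter fun j => ∀ v ∈ A j, S ω v).card : ℝ) - J.card * q ^ b with hX
  let I : Finset ℕ → Ω → ℝ := fun B ω => if ∀ v ∈ B, S ω v then 1 else 0
  have hXI : ∀ ω, X ω = ∑ j ∈ J, (I (A j) ω - q ^ b) := fun ω => by
    rw [sum_sub_distrib, sum_const, nsmul_eq_mul, hX]
    simp only [I, sum_boole]
  have hI : ∀ B ⊆ V, ∑ ω, I B ω = q ^ B.card * Fintype.card Ω := fun B hB => by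
    rw [← hS B hB]
    simp only [I, sum_boole]
  have hII : ∀ B C ω, I B ω * I C ω = I (B ∪ C) ω := fun B C ω => by
    simp only [I, mul_ite, mul_one, mul_zero, mem_union, or_imp, forall_and]
    split_ifs <;> first | rfl | (exfalso; tauto)
  -- Up to the factor `card Ω`, this is the covariance of two indicators. It vanishes for disjoint
  -- sets; otherwise it is at most the probability `q ^ b` of one of the events.
  have hcov : ∀ i ∈ J, ∀ j ∈ J, ∑ ω, (I (A i) ω - q ^ b) * (I (A j) ω - q ^ b) ≤
      if ¬ Disjoint (A i) (A j) then q ^ b * Fintype.card Ω else 0 := by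
    intro i hi j hj
    have e : ∀ ω, (I (A i) ω - q ^ b) * (I (A j) ω - q ^ b) =
        I (A i ∪ A j) ω - q ^ b * I (A i) ω - q ^ b * I (A j) ω + q ^ b * q ^ b := fun ω => by
      rw [← hII]; ring
    simp only [e, sum_add_distrib, sum_sub_distrib, ← mul_sum]
    rw [hI _ (union_subset (hA i hi) (hA j hj)), hI _ (hA i hi), hI _ (hA j hj), hb i hi, hb j hj,
      sum_const, nsmul_eq_mul, card_univ]
    split_ifs with hd
    · rw [card_union_of_disjoint hd, hb i hi, hb j hj, pow_add]
      apply le_of_eq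
      ring
    · have h1 : q ^ (A i ∪ A j).card ≤ q ^ b := by
        refine pow_le_pow_of_le_one hq hq1 ?_
        rw [← hb i hi]
        exact card_le_card subset_union_left
      have h2 : (0 : ℝ) ≤ Fintype.card Ω := Nat.cast_nonneg _
      have h3 := mul_le_mul_of_nonneg_right h1 h2
      have h4 : 0 ≤ q ^ b * (q ^ b * Fintype.card Ω) := by positivity
      linarith
  have hvar : ∑ ω, X ω ^ 2 ≤ M * q ^ b * Fintype.card Ω := by
    calc ∑ ω, X ω ^ 2 = ∑ i ∈ J, ∑ j ∈ J, ∑ ω, (I (A i) ω - q ^ b) * (I (A j) ω - q ^ b) := by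
          simp only [hXI, sq, sum_mul_sum]
          rw [sum_comm]
          exact sum_congr rfl fun i _ => sum_comm
      _ ≤ ∑ i ∈ J, ∑ j ∈ J, if ¬ Disjoint (A i) (A j) then q ^ b * Fintype.card Ω else 0 :=
          sum_le_sum fun i hi => sum_le_sum fun j hj => hcov i hi j hj
      _ = ((∑ i ∈ J, (J.filter fun j => ¬ Disjoint (A i) (A j)).card : ℕ) : ℝ) *
            (q ^ b * Fintype.card Ω) := by
          rw [Nat.cast_sum, sum_mul]
          refine sum_congr rfl fun i _ => ?_
          rw [← sum_filter, sum_const, nsmul_eq_mul]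
      _ ≤ M * (q ^ b * Fintype.card Ω) :=
          mul_le_mul_of_nonneg_right (by exact_mod_cast hM) (by positivity)
      _ = _ := by ring
  refine le_trans ?_ hvar
  calc ((univ.filter fun ω => a ≤ |X ω|).card : ℝ) * a ^ 2
      = ∑ ω ∈ univ.filter (fun ω => a ≤ |X ω|), a ^ 2 := by rw [sum_const, nsmul_eq_mul]
    _ ≤ ∑ ω ∈ univ.filter (fun ω => a ≤ |X ω|), X ω ^ 2 := by
        refine sum_le_sum fun ω hω => ?_
        rw [← sq_abs (X ω)]
        exact pow_le_pow_left₀ ha.le (mem_filter.1 hω).2 2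
    _ ≤ ∑ ω, X ω ^ 2 :=
        sum_le_sum_of_subset_of_nonneg (filter_subset _ _) fun ω _ _ => sq_nonneg _

open Finset in
/-- Markov's inequality for the number of sampled elements. -/
theorem card_sample_le {Ω : Type*} [Fintype Ω] (S : Ω → ℕ → Prop)
    [∀ ω, DecidablePred (S ω)] (V : Finset ℕ) (q : ℝ)
    (hS : ∀ v ∈ V, ((univ.filter fun ω => S ω v).card : ℝ) = q * Fintype.card Ω) (a : ℝ) :
    ((univ.filter fun ω => a ≤ ((V.filter (S ω)).card : ℝ)).card : ℝ) * a ≤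
      V.card * q * Fintype.card Ω := by
  calc _ = ∑ ω ∈ univ.filter (fun ω => a ≤ ((V.filter (S ω)).card : ℝ)), a := by
        rw [sum_const, nsmul_eq_mul]
    _ ≤ ∑ ω ∈ univ.filter (fun ω => a ≤ ((V.filter (S ω)).card : ℝ)),
          ((V.filter (S ω)).card : ℝ) := sum_le_sum fun ω hω => (mem_filter.1 hω).2
    _ ≤ ∑ ω, ((V.filter (S ω)).card : ℝ) :=
        sum_le_sum_of_subset_of_nonneg (filter_subset _ _) fun ω _ _ => Nat.cast_nonneg _
    _ = ∑ v ∈ V, ((univ.filter fun ω => S ω v).card : ℝ) := by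
        simp only [card_filter, Nat.cast_sum]
        exact sum_comm
    _ = _ := by rw [sum_congr rfl hS, sum_const, nsmul_eq_mul, mul_assoc]

/-- The inequality holds exactly for `j < Nat.log b n`. Counting such `j` makes the logarithm
visibly primitive recursive. -/
theorem Nat.log_eq_length_filter {b : ℕ} (hb : 1 < b) (n : ℕ) :
    Nat.log b n = ((List.range n).filter fun j => b ^ (j + 1) ≤ n).length := by
  rcases Nat.eq_zero_or_pos n with rfl | hn
  · simp
  have hL : Nat.log b n ≤ n := Nat.log_le_self b n
  obtain ⟨d, hd⟩ := Nat.exists_eq_add_of_le hL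
  have hfilter : (List.range n).filter (fun j => b ^ (j + 1) ≤ n) =
      (List.range n).filter (fun j => j < Nat.log b n) := by
    refine List.filter_congr fun j _ => ?_
    rw [decide_eq_decide, ← Nat.le_log_iff_pow_le hb hn.ne']
    exact Nat.succ_le_iff
  rw [hfilter, ← List.countP_eq_length_filter]
  generalize Nat.log b n = L at hd
  rw [hd, List.range_add, List.countP_append, List.countP_eq_length.2, List.countP_eq_zero.2]
  · simp
  · simp
  · simp

open Primrec in
theorem Primrec.nat_log {b : ℕ} (hb : 1 < b) : Primrec (Nat.log b) := by
  refine (list_length.comp (list_filter (f := List.range) (R := fun n j => b ^ (j + 1) ≤ n)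
    list_range ?_)).of_eq fun n => (Nat.log_eq_length_filter hb n).symm
  exact nat_le.comp (nat_pow'.comp (const b) (succ.comp snd)) fst

/-- Indexing by positions keeps parallel edges apart, as the second moment requires a sum over edges
with multiplicity. -/
theorem List.countP_eq_card_filter_getElem {α : Type*} (l : List α) (P : α → Prop)
    [DecidablePred P] :
    l.countP (fun e => P e) = (Finset.univ.filter fun j : Fin l.length => P l[j]).card := by
  rw [Finset.card_filter]
  refine Eq.trans ?_ (Fin.sum_univ_fun_getElem l fun e => if P e then 1 else 0).symm
  induction l with
  | nil => rfl
  | cons a l ih =>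
    rw [List.countP_cons, List.map_cons, List.sum_cons, ih, add_comm]
    simp

section Deviation

variable {k ℓ D n r : ℕ} {G : ColoredGraph k} {σ : List (ℕ × ℕ)}

open Classical in
/-- The number of pairs of edges with intersecting balls. -/
theorem sum_card_not_disjoint_le (hσ : (σ : Multiset (ℕ × ℕ)) = G.E) (hG : G.IsBounded D)
    (J : Finset (Fin σ.length)) :
    ∑ i ∈ J, (J.filter fun j => ¬ Disjoint (G.edgeBall ℓ σ[i]) (G.edgeBall ℓ σ[j])).card ≤
      σ.length * (2 * (D + 1) ^ ℓ * (D * (D + 1) ^ ℓ)) := by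
  have h : ∀ i ∈ J, (J.filter fun j =>
      ¬ Disjoint (G.edgeBall ℓ σ[i]) (G.edgeBall ℓ σ[j])).card ≤
      2 * (D + 1) ^ ℓ * (D * (D + 1) ^ ℓ) := by
    intro i _
    have hsub : (J.filter fun j => ¬ Disjoint (G.edgeBall ℓ σ[i]) (G.edgeBall ℓ σ[j])) ⊆
        (G.edgeBall ℓ σ[i]).biUnion fun v =>
          Finset.univ.filter fun j : Fin σ.length => v ∈ G.edgeBall ℓ σ[j] := by
      intro j hj
      obtain ⟨v, h1, h2⟩ := Finset.not_disjoint_iff.1 (Finset.mem_filter.1 hj).2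
      exact Finset.mem_biUnion.2 ⟨v, h1, Finset.mem_filter.2 ⟨Finset.mem_univ j, h2⟩⟩
    refine (Finset.card_le_card hsub).trans ((Finset.card_biUnion_le_card_mul _ _
      (D * (D + 1) ^ ℓ) fun v _ => ?_).trans
      (Nat.mul_le_mul_right _ (MGraph.card_edgeBall_le hG ℓ _)))
    rw [← List.countP_eq_card_filter_getElem σ (fun e => v ∈ G.edgeBall ℓ e)]
    have := MGraph.countP_mem_edgeBall_le hG ℓ v
    rw [← hσ, Multiset.coe_countP] at this
    convert this
  refine (Finset.sum_le_card_nsmul J _ _ h).trans ?_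
  rw [smul_eq_mul]
  refine Nat.mul_le_mul_right _ ((Finset.card_le_univ J).trans ?_)
  rw [Fintype.card_fin]

open Classical in
/-- The scaled number of sampled balls of a given type is close to the number of edges of this
type. -/
theorem card_bad_le (hσ : (σ : Multiset (ℕ × ℕ)) = G.E) (hG : G.IsBounded D)
    (hV : G.V = Finset.Icc 1 n) {t : ℕ} (ht : n * r ≤ t) {H : DRGraph k} {B Q : ℕ}
    (hB : H.V.card ≤ B) (hQ : Q * 2 ^ (r * B) ≤ σ.length) (hm : 0 < σ.length)
    {θ : ℝ} (hθ : 0 < θ) :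
    ((Finset.univ.filter fun ω : Fin t → Bool => θ * σ.length ≤
      |((σ.countP fun e => G.HasType ℓ H.type e ∧ ∀ v ∈ G.edgeBall ℓ e,
          v ∈ headsVerts r (fun j => (List.ofFn ω).getD j false) n : ℕ) : ℝ) *
            2 ^ (r * H.V.card) - G.typeCount ℓ H.type|).card : ℝ) * (θ ^ 2 * Q) ≤
      (2 * (D + 1) ^ ℓ * (D * (D + 1) ^ ℓ) : ℕ) * 2 ^ t := by
  set K := 2 * (D + 1) ^ ℓ * (D * (D + 1) ^ ℓ)
  set b := H.V.card
  set m := σ.length with hmdef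
  set q : ℝ := (1 / 2) ^ r with hq
  have hqpos : 0 < q := by positivity
  have hqb : q ^ b * 2 ^ (r * b) = 1 := by
    rw [hq, ← pow_mul, ← mul_pow]
    norm_num
  have hmpos : (0 : ℝ) < m := by exact_mod_cast hm
  let J : Finset (Fin σ.length) := Finset.univ.filter fun j => G.HasType ℓ H.type σ[j]
  have hJ : (J.card : ℝ) = G.typeCount ℓ H.type := by
    rw [← List.countP_eq_card_filter_getElem σ (fun e => G.HasType ℓ H.type e),
      ColoredGraph.typeCount, ← hσ, Multiset.coe_countP]
  have hY : ∀ ω : Fin t → Bool, (σ.countP fun e => G.HasType ℓ H.type e ∧ ∀ v ∈ G.edgeBall ℓ e,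
          v ∈ headsVerts r (fun j => (List.ofFn ω).getD j false) n) =
      (J.filter fun j => ∀ v ∈ G.edgeBall ℓ σ[j],
        v ∈ headsVerts r (fun j => (List.ofFn ω).getD j false) n).card := fun ω => by
    rw [List.countP_eq_card_filter_getElem σ (fun e => G.HasType ℓ H.type e ∧
      ∀ v ∈ G.edgeBall ℓ e, v ∈ headsVerts r (fun j => (List.ofFn ω).getD j false) n),
      Finset.filter_filter]
    congr!
  have key := card_deviation_le
    (S := fun (ω : Fin t → Bool) v => v ∈ headsVerts r (fun j => (List.ofFn ω).getD j false) n)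
    (Finset.Icc 1 n) q hqpos.le (pow_le_one₀ (by norm_num) (by norm_num))
    (fun A hA => by convert card_subset_headsVerts ht hA) J (fun j => G.edgeBall ℓ σ[j]) b (m * K)
    (fun j _ => hV ▸ G.edgeBall_subset ℓ _)
    (fun j hj => G.card_edgeBall_of_hasType (Finset.mem_filter.1 hj).2)
    -- The allowed deviation of the unscaled count is `θ * m * q ^ b`, which becomes `θ * m` after
    -- multiplication by `2 ^ (r * b)`.
    (by convert sum_card_not_disjoint_le hσ hG J) (a := θ * m * q ^ b) (by positivity)
  rw [hJ, Fintype.card_fun, Fintype.card_bool, Fintype.card_fin] at key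
  have hset : (Finset.univ.filter fun ω : Fin t → Bool => θ * m ≤
      |((σ.countP fun e => G.HasType ℓ H.type e ∧ ∀ v ∈ G.edgeBall ℓ e,
          v ∈ headsVerts r (fun j => (List.ofFn ω).getD j false) n : ℕ) : ℝ) *
            2 ^ (r * b) - G.typeCount ℓ H.type|) =
      Finset.univ.filter fun ω : Fin t → Bool => θ * m * q ^ b ≤
        |((J.filter fun j => ∀ v ∈ G.edgeBall ℓ σ[j],
          v ∈ headsVerts r (fun j => (List.ofFn ω).getD j false) n).card : ℝ) -
            G.typeCount ℓ H.type * q ^ b| := by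
    refine Finset.filter_congr fun ω _ => ?_
    rw [hY]
    set y : ℝ := ((J.filter fun j => ∀ v ∈ G.edgeBall ℓ σ[j],
          v ∈ headsVerts r (fun j => (List.ofFn ω).getD j false) n).card : ℝ)
    have e1 : y - G.typeCount ℓ H.type * q ^ b =
        (y * 2 ^ (r * b) - G.typeCount ℓ H.type) * q ^ b := by
      rw [sub_mul, mul_assoc, mul_comm (2 ^ (r * b)), hqb, mul_one]
    rw [e1, abs_mul, abs_of_pos (show (0 : ℝ) < q ^ b by positivity)]
    exact (mul_le_mul_iff_left₀ (by positivity)).symm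
  rw [hset]
  set c : ℝ := ((Finset.univ.filter fun ω : Fin t → Bool => θ * m * q ^ b ≤
        |((J.filter fun j => ∀ v ∈ G.edgeBall ℓ σ[j],
          v ∈ headsVerts r (fun j => (List.ofFn ω).getD j false) n).card : ℝ) -
            G.typeCount ℓ H.type * q ^ b|).card : ℝ)
  have key' : c * (θ * m * q ^ b) ^ 2 ≤ (m * K : ℕ) * q ^ b * (2 ^ t : ℕ) := by
    convert key
  -- The threshold uses the largest ball size `B`, so it also serves every smaller `b`.
  have hQ' : (Q : ℝ) ≤ m * q ^ b := by
    have h1 : Q * 2 ^ (r * b) ≤ m := (Nat.mul_le_mul_left Q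
      (Nat.pow_le_pow_right two_pos (Nat.mul_le_mul_left r hB))).trans hQ
    have h2 : (Q : ℝ) * 2 ^ (r * b) ≤ m := by exact_mod_cast h1
    have h3 := mul_le_mul_of_nonneg_right h2 (show (0 : ℝ) ≤ q ^ b by positivity)
    rwa [mul_assoc, mul_comm (2 ^ (r * b)), hqb, mul_one] at h3
  have hc : 0 ≤ c := Nat.cast_nonneg _
  have h4 : (c * (θ ^ 2 * (m * q ^ b))) * (m * q ^ b) ≤ (K * 2 ^ t) * (m * q ^ b) := by
    push_cast at key'
    nlinarith [key']
  have h5 := le_of_mul_le_mul_right h4 (by positivity)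
  refine le_trans ?_ h5
  gcongr

open Classical in
/-- The sample is not much larger than expected. -/
theorem card_large_sample_le {t : ℕ} (ht : n * r ≤ t) (hn : 0 < n) (Q : ℕ) :
    ((Finset.univ.filter fun ω : Fin t → Bool => Q * (n / 2 ^ r + 1) ≤
      (headsVerts r (fun j => (List.ofFn ω).getD j false) n).length).card : ℝ) * Q ≤ 2 ^ t := by
  have key := card_sample_le
    (S := fun (ω : Fin t → Bool) v => v ∈ headsVerts r (fun j => (List.ofFn ω).getD j false) n)
    (Finset.Icc 1 n) ((1 / 2) ^ r) (fun v hv => by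
      have h := card_subset_headsVerts ht (Finset.singleton_subset_iff.2 hv)
      simp only [Finset.mem_singleton, forall_eq, Finset.card_singleton, pow_one] at h
      convert h) ((Q * (n / 2 ^ r + 1) : ℕ) : ℝ)
  have hlen : ∀ ω : Fin t → Bool,
      ((Finset.Icc 1 n).filter fun v =>
        v ∈ headsVerts r (fun j => (List.ofFn ω).getD j false) n).card =
      (headsVerts r (fun j => (List.ofFn ω).getD j false) n).length := fun ω => by
    rw [← List.toFinset_card_of_nodup (nodup_headsVerts _ _ _)]
    congr 1
    ext v
    rw [Finset.mem_filter, List.mem_toFinset, and_iff_right_iff_imp]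
    exact fun h => (mem_headsVerts.1 h).1
  simp only [hlen, Nat.cast_le, Nat.card_Icc, Nat.add_sub_cancel] at key
  rw [Fintype.card_fun, Fintype.card_bool, Fintype.card_fin] at key
  set c : ℝ := ((Finset.univ.filter fun ω : Fin t → Bool => Q * (n / 2 ^ r + 1) ≤
      (headsVerts r (fun j => (List.ofFn ω).getD j false) n).length).card : ℝ)
  have hpos : (0 : ℝ) < n * (1 / 2) ^ r := by positivity
  -- The expected sample size is at most the integer `n / 2 ^ r + 1`, so Markov's inequality gives
  -- probability at most `1 / Q`.
  have hdiv : (n : ℝ) * (1 / 2) ^ r ≤ (n / 2 ^ r + 1 : ℕ) := by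
    have h1 : n < 2 ^ r * (n / 2 ^ r + 1) := Nat.lt_mul_div_succ n (by positivity)
    have h2 : (n : ℝ) ≤ 2 ^ r * (n / 2 ^ r + 1 : ℕ) := by exact_mod_cast h1.le
    rw [one_div, inv_pow, ← div_eq_mul_inv, div_le_iff₀ (by positivity), mul_comm]
    exact h2
  have hc : 0 ≤ c := Nat.cast_nonneg _
  have h3 : (c * Q) * (n * (1 / 2) ^ r) ≤ 2 ^ t * (n * (1 / 2) ^ r) := by
    calc (c * Q) * (n * (1 / 2) ^ r) ≤ (c * Q) * (n / 2 ^ r + 1 : ℕ) := by gcongr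
      _ = c * ((Q * (n / 2 ^ r + 1) : ℕ) : ℝ) := by push_cast; ring
      _ ≤ _ := key
      _ = _ := by push_cast; ring
  exact le_of_mul_le_mul_right h3 hpos

end Deviation

/-! ### Normalization of the estimates -/

/-- Weights close to the entries of a counting vector give a distribution close in total
variation. -/
theorem tvDist_weightDist_le {N : ℕ} (w c : Fin N → ℕ) {m : ℕ} (hm : 0 < m)
    (hc : ∑ i, c i = m) {θ ε : ℝ} (h : ∀ i, |(w i : ℝ) - c i| ≤ θ * m) (hθ : N * θ ≤ 1 / 2)
    (hε : N * θ ≤ ε) :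
    (∃ i : Fin N, 0 < (List.ofFn w).getD i 0) ∧
      tvDist (weightDist N (List.ofFn w)) (fun i => (c i : ℝ) / m) ≤ ε := by
  have hget : ∀ i : Fin N, (List.ofFn w).getD i 0 = w i := fun i => by
    simp [List.getD_eq_getElem?_getD]
  simp only [hget]
  have hm' : (0 : ℝ) < m := by exact_mod_cast hm
  set W : ℝ := ∑ i, (w i : ℝ) with hW
  have hc' : ∑ i, (c i : ℝ) = m := by exact_mod_cast hc
  have hsum : ∑ i, |(w i : ℝ) - c i| ≤ N * θ * m := by
    refine (Finset.sum_le_sum fun i _ => h i).trans (le_of_eq ?_)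
    rw [Finset.sum_const, Finset.card_univ, Fintype.card_fin, nsmul_eq_mul, mul_assoc]
  have hWm : |W - m| ≤ N * θ * m := by
    rw [hW, ← hc', ← Finset.sum_sub_distrib, hc']
    exact (Finset.abs_sum_le_sum_abs _ _).trans hsum
  -- From `N * θ ≤ 1 / 2` the total weight is at least `m / 2`, so the normalization makes sense.
  have hWpos : 0 < W := by
    have h1 := (abs_le.1 hWm).1
    nlinarith
  constructor
  · by_contra hcon
    push Not at hcon
    have : W = 0 := Finset.sum_eq_zero fun i _ => by exact_mod_cast Nat.le_zero.1 (hcon i)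
    exact hWpos.ne' this
  · have hpt : ∀ i, |weightDist N (List.ofFn w) i - (c i : ℝ) / m| ≤
        (w i : ℝ) * (|W - m| / (W * m)) + |(w i : ℝ) - c i| / m := by
      intro i
      simp only [weightDist, hget]
      rw [← hW]
      -- The first term is the error of the normalization, the second that of the single weight.
      -- Summed over `i` each contributes at most `N * θ`, and the factor `1 / 2` in the distance
      -- leaves `N * θ`.
      have e : (w i : ℝ) / W - c i / m = -((w i : ℝ) * ((W - m) / (W * m))) +
          ((w i : ℝ) - c i) / m := by
        field_simp
        ring
      rw [e]
      refine (abs_add_le _ _).trans (le_of_eq ?_)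
      rw [abs_neg, abs_mul, abs_div, abs_div, abs_of_nonneg (Nat.cast_nonneg (α := ℝ) (w i)),
        abs_of_pos (mul_pos hWpos hm'), abs_of_pos hm']
    have htot : ∑ i, |weightDist N (List.ofFn w) i - (c i : ℝ) / m| ≤ 2 * (N * θ) := by
      refine (Finset.sum_le_sum fun i _ => hpt i).trans ?_
      rw [Finset.sum_add_distrib, ← Finset.sum_mul, ← Finset.sum_div, ← hW]
      have e1 : W * (|W - m| / (W * m)) = |W - m| / m := by field_simp
      rw [e1, two_mul]
      refine add_le_add ?_ ?_
      · rwa [div_le_iff₀ hm']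
      · rwa [div_le_iff₀ hm']
    rw [tvDist]
    linarith

/-! ### Choice of parameters and the space bound -/

/-- The number of coins per vertex: the sampling probability is about `n ^ (-1 / (2 * B))`. -/
def coinsPerVertex (B n : ℕ) : ℕ := Nat.log (2 ^ (2 * B)) n + 1

/-- The length up to which a stream is stored completely. -/
def keepBound (B Q n : ℕ) : ℕ := Q * 2 ^ (coinsPerVertex B n * B)

/-- The number of records for which there is room. -/
def capBound (B Q D n : ℕ) : ℕ :=
  keepBound B Q n + (D + 1) * (Q * (n / 2 ^ coinsPerVertex B n + 1))

section Primrec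

open Primrec

variable {B : ℕ} (hB : 0 < B)
include hB

theorem primrec_coinsPerVertex : Primrec (coinsPerVertex B) :=
  succ.comp (Primrec.nat_log (Nat.one_lt_two_pow (by omega)))

theorem primrec_keepBound (Q : ℕ) : Primrec (keepBound B Q) :=
  nat_mul.comp (const Q) (nat_pow'.comp (const 2)
    (nat_mul.comp (primrec_coinsPerVertex hB) (const B)))

theorem primrec_capBound (Q D : ℕ) : Primrec (capBound B Q D) :=
  nat_add.comp (primrec_keepBound hB Q) (nat_mul.comp (const (D + 1)) (nat_mul.comp (const Q)
    (succ.comp (nat_div.comp .id (nat_pow'.comp (const 2) (primrec_coinsPerVertex hB))))))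

end Primrec

/-- The sampling algorithm that estimates the number of edges with each of the given patterns. -/
noncomputable def typeSampler {B : ℕ} (hB : 0 < B) (Q D : ℕ) {N : ℕ} {b : Fin N → ℕ}
    (P : ∀ i, Pattern (b i)) : SampAlg where
  tosses := coinsPerVertex B
  keep := keepBound B Q
  cap := capBound B Q D
  out s := List.ofFn fun i => estimate (coinsPerVertex B) (keepBound B Q) (P i) s
  primrec_tosses := primrec_coinsPerVertex hB
  primrec_keep := primrec_keepBound hB Q
  primrec_cap := primrec_capBound hB Q D
  primrec_out := Primrec.list_ofFn fun i =>
    primrec_estimate (primrec_coinsPerVertex hB) (primrec_keepBound hB Q) (P i)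

section Space

variable {B n : ℕ}

theorem rpow_le_two_pow_coinsPerVertex (hB : 0 < B) :
    (n : ℝ) ^ (1 / (2 * B : ℝ)) ≤ 2 ^ coinsPerVertex B n := by
  have h : n < (2 ^ (2 * B)) ^ coinsPerVertex B n :=
    Nat.lt_pow_succ_log_self (Nat.one_lt_two_pow (by omega)) n
  have h' : (n : ℝ) ≤ (2 ^ coinsPerVertex B n) ^ (2 * B) := by
    rw [← pow_mul, mul_comm _ (2 * B), pow_mul]
    exact_mod_cast h.le
  refine (Real.rpow_le_rpow (Nat.cast_nonneg n) h' (by positivity)).trans (le_of_eq ?_)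
  have e : (1 / (2 * B : ℝ)) = ((2 * B : ℕ) : ℝ)⁻¹ := by push_cast; rw [one_div]
  rw [e, Real.pow_rpow_inv_natCast (by positivity) (by omega)]

/-- With `L = Nat.log (2 ^ (2 * B)) n`, the square of `2 ^ (L * B)` is at most `n`. The `+ 1` in the
number of coins costs the factor `2 ^ B`. -/
theorem two_pow_le_sqrt (hn : 0 < n) :
    (2 : ℝ) ^ (coinsPerVertex B n * B) ≤ 2 ^ B * (n : ℝ) ^ (1 / 2 : ℝ) := by
  have h : (2 ^ (2 * B)) ^ Nat.log (2 ^ (2 * B)) n ≤ n := Nat.pow_log_le_self _ hn.ne'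
  have h' : ((2 : ℝ) ^ (Nat.log (2 ^ (2 * B)) n * B)) ^ 2 ≤ n := by
    rw [← pow_mul, show Nat.log (2 ^ (2 * B)) n * B * 2 = 2 * B * Nat.log (2 ^ (2 * B)) n by ring,
      pow_mul]
    exact_mod_cast h
  rw [coinsPerVertex, add_mul, one_mul, pow_add, mul_comm]
  refine mul_le_mul_of_nonneg_left ?_ (by positivity)
  rw [← Real.sqrt_eq_rpow]
  exact Real.le_sqrt_of_sq_le h'

/-- The stored prefix has order `√n` and the sample part order `n ^ (1 - 1 / (2 * B))`. The latter
dominates because `B` is at least `1`. -/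
theorem capBound_le (hB : 0 < B) (hn : 0 < n) (Q D : ℕ) :
    (capBound B Q D n : ℝ) + 2 ≤
      (Q * 2 ^ B + (D + 1) * (Q * 2) + 2) * (n : ℝ) ^ (1 - 1 / (2 * B : ℝ)) := by
  have hn1 : (1 : ℝ) ≤ n := by exact_mod_cast hn
  have hB1 : (1 : ℝ) ≤ B := by exact_mod_cast hB
  have hs : 1 / (2 * B : ℝ) ≤ 1 / 2 := by
    rw [div_le_div_iff_of_pos_left one_pos (by positivity) two_pos]
    linarith
  set x : ℝ := (n : ℝ) ^ (1 - 1 / (2 * B : ℝ)) with hx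
  have hx1 : 1 ≤ x := Real.one_le_rpow hn1 (by linarith)
  have h1 : (keepBound B Q n : ℝ) ≤ Q * 2 ^ B * x := by
    rw [keepBound]
    push_cast
    rw [mul_assoc]
    refine mul_le_mul_of_nonneg_left ((two_pow_le_sqrt hn).trans ?_) (Nat.cast_nonneg Q)
    exact mul_le_mul_of_nonneg_left (Real.rpow_le_rpow_of_exponent_le hn1 (by linarith))
      (by positivity)
  have h2 : ((n / 2 ^ coinsPerVertex B n : ℕ) : ℝ) ≤ x := by
    refine Nat.cast_div_le.trans ?_
    push_cast
    rw [hx, Real.rpow_sub (by linarith), Real.rpow_one]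
    exact div_le_div_of_nonneg_left (by linarith) (Real.rpow_pos_of_pos (by linarith) _)
      (rpow_le_two_pow_coinsPerVertex hB)
  rw [capBound]
  push_cast
  have h3 : ((D : ℝ) + 1) * (Q * (((n / 2 ^ coinsPerVertex B n : ℕ) : ℝ) + 1)) ≤
      (D + 1) * (Q * (2 * x)) := by
    refine mul_le_mul_of_nonneg_left (mul_le_mul_of_nonneg_left ?_ (Nat.cast_nonneg Q))
      (by positivity)
    linarith
  nlinarith

theorem log_le_rpow (hn : 0 < n) {s : ℝ} (hs : 0 < s) (a : ℕ) :
    ((16 * (a + 2 * (Nat.log 2 n + 1)) + 1 : ℕ) : ℝ) ≤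
      (16 * a + 33 + 32 / (s * Real.log 2)) * (n : ℝ) ^ s := by
  have hn1 : (1 : ℝ) ≤ n := by exact_mod_cast hn
  have hlog2 : 0 < Real.log 2 := Real.log_pos one_lt_two
  have h1 : (Nat.log 2 n : ℝ) ≤ (n : ℝ) ^ s / (s * Real.log 2) := by
    have h := Real.natLog_le_logb n 2
    have h2 := Real.log_le_rpow_div (x := n) (by linarith) hs
    rw [← div_div]
    refine h.trans ?_
    rw [Real.logb]
    push_cast
    exact div_le_div_of_nonneg_right h2 hlog2.le
  have h2 : 1 ≤ (n : ℝ) ^ s := Real.one_le_rpow hn1 hs.le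
  have h3 : (16 * (a : ℝ) + 33) * 1 ≤ (16 * a + 33) * (n : ℝ) ^ s :=
    mul_le_mul_of_nonneg_left h2 (by positivity)
  push_cast
  have e : (16 * (a : ℝ) + 33 + 32 / (s * Real.log 2)) * (n : ℝ) ^ s =
      (16 * a + 33) * (n : ℝ) ^ s + 32 * ((n : ℝ) ^ s / (s * Real.log 2)) := by ring
  rw [e]
  linarith

end Space

theorem typeSampler_space {B : ℕ} (hB : 0 < B) (Q D : ℕ) {N : ℕ} {b : Fin N → ℕ}
    (P : ∀ i, Pattern (b i)) (k : ℕ) :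
    ∃ C : ℝ, ∀ (n : ℕ) (G : ColoredGraph k), G.V = Finset.Icc 1 n → G.IsBounded D → G.E ≠ 0 →
      ∀ σ : List (ℕ × ℕ), (σ : Multiset (ℕ × ℕ)) = G.E → ∀ coins : List Bool,
        (memBits ((typeSampler hB Q D P).toStreamAlg.memory n G.χ σ coins) : ℝ) ≤
          C * (n : ℝ) ^ (1 - 1 / (4 * B : ℝ)) := by
  -- With this `a`, the number `a * (n * n)` bounds everything in the state: colors by `k`, edges by
  -- `D * n`, phases by `3`, tosses by `2 * n ^ 2`.
  set a := k + D + 3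
  refine ⟨(Q * 2 ^ B + (D + 1) * (Q * 2) + 2) *
    (16 * a + 33 + 32 / (1 / (4 * B : ℝ) * Real.log 2)), fun n G hV hG hE σ hσ coins => ?_⟩
  have hmem : ∀ e ∈ σ, e.1 ∈ Finset.Icc 1 n ∧ e.2 ∈ Finset.Icc 1 n := fun e he => by
    rw [← Multiset.mem_coe, hσ] at he
    exact ⟨hV ▸ G.mem_left e he, hV ▸ G.mem_right e he⟩
  obtain ⟨e, he⟩ := Multiset.exists_mem_of_ne_zero hE
  have hn : 0 < n := by
    have := Finset.mem_Icc.1 (hV ▸ G.mem_left e he)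
    omega
  have hnn : n ≤ n * n := Nat.le_mul_of_pos_left n hn
  have hW : ∀ x y, x ≤ a → y ≤ n * n → x * y ≤ a * (n * n) := fun x y => Nat.mul_le_mul
  have hk : ∀ x ≤ a, x ≤ a * (n * n) := fun x hx => by
    simpa using hW x 1 hx (by omega)
  have hlen : σ.length ≤ D * n := by
    have := MGraph.card_edges_le hG
    rwa [← hσ, Multiset.coe_card, hV, Nat.card_Icc, Nat.add_sub_cancel] at this
  have hbits := (typeSampler hB Q D P).memBits_memory_le (n := n) (W := a * (n * n))
    (w := a + 2 * (Nat.log 2 n + 1)) (χ := G.χ) ?_ ?_ ?_ ?_ σ hmem ?_ ?_ coins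
  · have h1 := capBound_le hB hn Q D
    have h2 := log_le_rpow hn (s := 1 / (4 * B : ℝ)) (by positivity) a
    -- The first factor pays for the number of records, the second for the logarithmic size of each.
    have e : (n : ℝ) ^ (1 - 1 / (4 * B : ℝ)) =
        (n : ℝ) ^ (1 - 1 / (2 * B : ℝ)) * (n : ℝ) ^ (1 / (4 * B : ℝ)) := by
      rw [← Real.rpow_add (by exact_mod_cast hn)]
      congr 1
      field_simp
      ring
    rw [e]
    have hbits' : (memBits ((typeSampler hB Q D P).toStreamAlg.memory n G.χ σ coins) : ℝ) ≤
        ((capBound B Q D n : ℝ) + 2) * ((16 * (a + 2 * (Nat.log 2 n + 1)) + 1 : ℕ) : ℝ) := by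
      exact_mod_cast hbits
    refine hbits'.trans ((mul_le_mul h1 h2 (Nat.cast_nonneg _) (by positivity)).trans
      (le_of_eq (by ring)))
  · have hr : coinsPerVertex B n ≤ 2 * n := by
      have := Nat.log_le_self (2 ^ (2 * B)) n
      rw [coinsPerVertex]
      omega
    calc n * coinsPerVertex B n ≤ n * (2 * n) := Nat.mul_le_mul_left n hr
      _ = 2 * (n * n) := by ring
      _ ≤ _ := hW 2 _ (by omega) le_rfl
  · simpa using hW 1 n (by omega) hnn
  · exact hk 3 (by omega)
  · intro v hv
    have := Finset.mem_Icc.1 (G.color_mem v (hV ▸ hv))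
    exact hk _ (by omega)
  · exact hlen.trans (hW D n (by omega) hnn)
  · have h1 : n < 2 ^ (Nat.log 2 n + 1) := Nat.lt_pow_succ_log_self one_lt_two n
    have h2 : a < 2 ^ a := Nat.lt_two_pow_self
    have e : 2 ^ (a + 2 * (Nat.log 2 n + 1)) =
        2 ^ a * (2 ^ (Nat.log 2 n + 1) * 2 ^ (Nat.log 2 n + 1)) := by ring
    rw [e]
    exact Nat.mul_lt_mul'' h2 (Nat.mul_lt_mul'' h1 h1)

/-! ### Correctness and conclusion -/

open Classical in
/-- With high probability the sampling algorithm outputs good weights. -/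
theorem typeSampler_correct {k ℓ D N n : ℕ} (enum : Fin N ≃ dbTypes k ℓ D) {B : ℕ} (hB : 0 < B)
    (H : Fin N → DRGraph k) (hT : ∀ i, (H i).type = enum i)
    (hH : ∀ i, ∀ v ∈ (H i).V, v ∈ (H i).edgeBall ℓ (H i).root) (hHB : ∀ i, (H i).V.card ≤ B)
    {θ ε δ : ℝ} (hθ : 0 < θ) (hθ2 : N * θ ≤ 1 / 2) (hθε : N * θ ≤ ε) {Q : ℕ} (hQ : 0 < Q)
    (hQδ : 1 + N * ((2 * (D + 1) ^ ℓ * (D * (D + 1) ^ ℓ) : ℕ) / θ ^ 2) ≤ δ * Q)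
    {G : ColoredGraph k} (hV : G.V = Finset.Icc 1 n) (hG : G.IsBounded D) (hE : G.E ≠ 0)
    {σ : List (ℕ × ℕ)} (hσ : (σ : Multiset (ℕ × ℕ)) = G.E) :
    let A := (typeSampler hB Q D fun i =>
      (H i).pattern ℓ (H i).V.equivFin.symm).toStreamAlg
    ∃ t : ℕ,
      (∀ coins : List Bool, coins.length = t →
        ∃ w, A.action (A.memory n G.χ σ coins) = .output w) ∧
      1 - δ ≤ coinProb t fun coins =>
        ∃ w, A.action (A.memory n G.χ σ coins) = .output w ∧
          (∃ i : Fin N, 0 < w.getD i 0) ∧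
          tvDist (weightDist N w) (fun i => G.edgeDist ℓ (enum i)) ≤ ε := by
  intro A
  set p := typeSampler hB Q D fun i => (H i).pattern ℓ (H i).V.equivFin.symm
  set r := coinsPerVertex B n
  set m := σ.length with hm
  have hcard : Multiset.card G.E = m := by rw [← hσ, Multiset.coe_card]
  have hmpos : 0 < m := by
    rw [← hcard]
    exact Multiset.card_pos.2 hE
  have hmem : ∀ e ∈ σ, e.1 ∈ Finset.Icc 1 n ∧ e.2 ∈ Finset.Icc 1 n := fun e he => by
    rw [← Multiset.mem_coe, hσ] at he
    exact ⟨hV ▸ G.mem_left e he, hV ▸ G.mem_right e he⟩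
  have hne : ∀ e ∈ σ, e.1 ≠ e.2 := fun e he => G.loopless e (by rwa [← Multiset.mem_coe, hσ] at he)
  have hn : 0 < n := by
    obtain ⟨e, he⟩ := Multiset.exists_mem_of_ne_zero hE
    have := Finset.mem_Icc.1 (hV ▸ G.mem_left e he)
    omega
  have hr : 0 < p.tosses n := Nat.succ_pos _
  set t := n * p.tosses n + 3 * σ.length + 1 with ht
  have hrt : n * r ≤ t := by
    change n * p.tosses n ≤ t
    omega
  refine ⟨t, fun coins hc => ?_, ?_⟩
  · obtain ⟨R, h, -⟩ := p.act_run (χ := G.χ) hr σ hmem coins hc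
    exact ⟨_, (p.action_memory n G.χ σ coins).trans h⟩
  let S : (Fin t → Bool) → List ℕ := fun ω =>
    headsVerts r (fun j => (List.ofFn ω).getD j false) n
  let Y : Fin N → (Fin t → Bool) → ℕ := fun i ω =>
    σ.countP fun e => G.HasType ℓ (H i).type e ∧ ∀ v ∈ G.edgeBall ℓ e, v ∈ S ω
  let bad₀ : Finset (Fin t → Bool) :=
    Finset.univ.filter fun ω => Q * (n / 2 ^ r + 1) ≤ (S ω).length
  -- For a short stream these sets are empty by definition, since the estimate is then exact.
  let bad : Fin N → Finset (Fin t → Bool) := fun i => Finset.univ.filter fun ω =>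
    ¬ m ≤ keepBound B Q n ∧
      θ * m ≤ |(Y i ω : ℝ) * 2 ^ (r * (H i).V.card) - G.typeCount ℓ (H i).type|
  have hgood : ∀ ω, ω ∉ bad₀ → (∀ i, ω ∉ bad i) →
      ∃ w, A.action (A.memory n G.χ σ (List.ofFn ω)) = .output w ∧
        (∃ i : Fin N, 0 < w.getD i 0) ∧
        tvDist (weightDist N w) (fun i => G.edgeDist ℓ (enum i)) ≤ ε := by
    intro ω h0 hi
    have h0' : (S ω).length < Q * (n / 2 ^ r + 1) := by simpa [bad₀] using h0
    obtain ⟨R, h, hR⟩ := p.act_run (χ := G.χ) hr σ hmem (List.ofFn ω) (by simp [ht])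
    have hlen : (S ω).length + (recordedEdges (p.keep n) (S ω) G.χ 0 σ).length ≤ p.cap n := by
      have h1 := length_recordedEdges_le (p.keep n) (S ω) G.χ 0 σ
      have hsub : (S ω).toFinset ⊆ G.V := fun v hv => by
        rw [hV]
        exact (mem_headsVerts.1 (List.mem_toFinset.1 hv)).1
      have h2 := MGraph.countP_touch_le_mul hG hsub
      have hcardS : (S ω).toFinset.card = (S ω).length :=
        List.toFinset_card_of_nodup (nodup_headsVerts _ _ _)
      rw [← hσ, Multiset.coe_countP, hcardS] at h2
      simp only [List.mem_toFinset] at h2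
      -- Besides the stored prefix, each sampled vertex needs one record for itself and accounts for
      -- at most `D` incident edges.
      have h3 : (D + 1) * (S ω).length ≤ (D + 1) * (Q * (n / 2 ^ r + 1)) :=
        Nat.mul_le_mul_left _ h0'.le
      change _ ≤ p.keep n + (D + 1) * (Q * (n / 2 ^ r + 1))
      rw [add_mul, one_mul] at h3
      omega
    obtain rfl := hR (S ω) rfl hne hlen
    refine ⟨_, (p.action_memory n G.χ σ _).trans h, ?_⟩
    simp only [G.edgeDist_eq, hcard]
    refine tvDist_weightDist_le _ _ hmpos (by rw [G.sum_typeCount hG enum, hcard]) (fun i => ?_)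
      hθ2 hθε
    by_cases hs : m ≤ keepBound B Q n
    · have := estimate_short (r := coinsPerVertex B) (keep := keepBound B Q) hσ
        (H i).V.equivFin.symm (hH i) n (S ω) hs
      change |((estimate (coinsPerVertex B) (keepBound B Q)
        ((H i).pattern ℓ (H i).V.equivFin.symm) (n, σ.length, (S ω).map loopRec ++
          recordedEdges (keepBound B Q n) (S ω) G.χ 0 σ) : ℕ) : ℝ) - _| ≤ _
      rw [this, hT, sub_self, abs_zero]
      positivity
    · have := estimate_long (r := coinsPerVertex B) (keep := keepBound B Q) hσ
        (H i).V.equivFin.symm (hH i) n (S ω) hs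
      change |((estimate (coinsPerVertex B) (keepBound B Q)
        ((H i).pattern ℓ (H i).V.equivFin.symm) (n, σ.length, (S ω).map loopRec ++
          recordedEdges (keepBound B Q n) (S ω) G.χ 0 σ) : ℕ) : ℝ) - _| ≤ _
      rw [this, ← hT]
      have hi' := hi i
      simp only [bad, Finset.mem_filter, Finset.mem_univ, true_and, hs, not_false_eq_true,
        not_le] at hi'
      push_cast
      exact hi'.le
  have hQ' : (0 : ℝ) < Q := by exact_mod_cast hQ
  set K : ℕ := 2 * (D + 1) ^ ℓ * (D * (D + 1) ^ ℓ)
  have hbad₀ : (bad₀.card : ℝ) ≤ 2 ^ t / Q := by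
    rw [le_div_iff₀ hQ']
    exact card_large_sample_le hrt hn Q
  have hbad : ∀ i, ((bad i).card : ℝ) ≤ K / θ ^ 2 * (2 ^ t / Q) := by
    intro i
    by_cases hs : m ≤ keepBound B Q n
    · have : bad i = ∅ := by simp [bad, hs]
      rw [this, Finset.card_empty, Nat.cast_zero]
      positivity
    · have h := card_bad_le (ℓ := ℓ) hσ hG hV hrt (hHB i) (not_le.1 hs).le hmpos hθ
      have e : K / θ ^ 2 * ((2 : ℝ) ^ t / Q) = K * 2 ^ t / (θ ^ 2 * Q) := by
        field_simp
      rw [e, le_div_iff₀ (by positivity)]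
      simpa only [bad, hs, not_false_eq_true, true_and] using h
  rw [coinProb, le_div_iff₀ (by positivity)]
  have hcover : (Finset.univ : Finset (Fin t → Bool)) ⊆
      (Finset.univ.filter fun ω : Fin t → Bool =>
        ∃ w, A.action (A.memory n G.χ σ (List.ofFn ω)) = .output w ∧
          (∃ i : Fin N, 0 < w.getD i 0) ∧
          tvDist (weightDist N w) (fun i => G.edgeDist ℓ (enum i)) ≤ ε) ∪
        (bad₀ ∪ Finset.univ.biUnion bad) := by
    intro ω _
    by_cases h0 : ω ∈ bad₀
    · exact Finset.mem_union_right _ (Finset.mem_union_left _ h0)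
    by_cases hi : ∀ i, ω ∉ bad i
    · exact Finset.mem_union_left _ (Finset.mem_filter.2 ⟨Finset.mem_univ ω, hgood ω h0 hi⟩)
    · push Not at hi
      obtain ⟨i, hi⟩ := hi
      exact Finset.mem_union_right _ (Finset.mem_union_right _
        (Finset.mem_biUnion.2 ⟨i, Finset.mem_univ i, hi⟩))
  have hcount := (Finset.card_le_card hcover).trans ((Finset.card_union_le _ _).trans
    (Nat.add_le_add_left ((Finset.card_union_le _ _).trans
      (Nat.add_le_add_left Finset.card_biUnion_le _)) _))
  rw [Finset.card_univ, Fintype.card_fun, Fintype.card_bool, Fintype.card_fin] at hcount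
  have hcount' := (Nat.cast_le (α := ℝ)).2 hcount
  push_cast at hcount'
  have hsum : ∑ i, ((bad i).card : ℝ) ≤ N * (K / θ ^ 2 * (2 ^ t / Q)) := by
    refine (Finset.sum_le_sum fun i _ => hbad i).trans (le_of_eq ?_)
    rw [Finset.sum_const, Finset.card_univ, Fintype.card_fin, nsmul_eq_mul]
  -- Union bound: `1 / Q` for an oversized sample and `K / (θ ^ 2 * Q)` for each of the `N` types.
  have htot : (2 : ℝ) ^ t / Q + N * (K / θ ^ 2 * (2 ^ t / Q)) ≤ δ * 2 ^ t := by
    have h := mul_le_mul_of_nonneg_right hQδ (show (0 : ℝ) ≤ 2 ^ t / Q by positivity)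
    have e1 : δ * Q * ((2 : ℝ) ^ t / Q) = δ * 2 ^ t := by field_simp
    rw [e1] at h
    refine le_trans (le_of_eq ?_) h
    ring
  rw [sub_mul, one_mul]
  linarith

theorem mainTheorem5 (k ℓ D : ℕ) (ε δ : ℝ) (hε : 0 < ε) (hδ : 0 < δ) :
    Finite (dbTypes k ℓ D) ∧
    ∃ c : ℝ, 0 < c ∧
      ∀ (N : ℕ) (enum : Fin N ≃ dbTypes k ℓ D),
      ∃ (A : StreamAlg) (C : ℝ),
        ∀ (n : ℕ) (G : ColoredGraph k), G.V = Finset.Icc 1 n → G.IsBounded D → G.E ≠ 0 →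
        ∀ σ : List (ℕ × ℕ), (σ : Multiset (ℕ × ℕ)) = G.E →
          -- the space bound, at every moment and for every outcome of the coins
          (∀ coins : List Bool,
            (memBits (A.memory n G.χ σ coins) : ℝ) ≤ C * (n : ℝ) ^ (1 - c)) ∧
          ∃ t : ℕ,
            -- the algorithm always stops
            (∀ coins : List Bool, coins.length = t →
              ∃ w, A.action (A.memory n G.χ σ coins) = .output w) ∧
            -- and its output is good, except with probability at most `δ`
            1 - δ ≤ coinProb t fun coins =>
              ∃ w, A.action (A.memory n G.χ σ coins) = .output w ∧
                (∃ i : Fin N, 0 < w.getD i 0) ∧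
                tvDist (weightDist N w) (fun i => G.edgeDist ℓ (enum i)) ≤ ε := by
  set B := 2 * (D + 1) ^ ℓ with hBdef
  have hB : 0 < B := by positivity
  refine ⟨finite_dbTypes k ℓ D, 1 / (4 * B : ℝ), by positivity, fun N enum => ?_⟩
  choose H hT hb hH using fun i => (enum i).2
  -- The denominator `N + 1` gives `N * θ ≤ min ε (1 / 2)` and also covers `N = 0`.
  set θ : ℝ := min ε (1 / 2) / (N + 1) with hθdef
  have hmin : 0 < min ε (1 / 2) := lt_min hε (by norm_num)
  have hθ : 0 < θ := by positivity
  have hNθ : N * θ ≤ min ε (1 / 2) := by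
    rw [hθdef, mul_div_assoc', div_le_iff₀ (by positivity), mul_comm]
    exact mul_le_mul_of_nonneg_left (by linarith) hmin.le
  obtain ⟨Q, hQ⟩ := exists_nat_ge
    ((1 + N * ((2 * (D + 1) ^ ℓ * (D * (D + 1) ^ ℓ) : ℕ) / θ ^ 2)) / δ)
  have hQpos : 0 < Q := by
    have : (0 : ℝ) < Q := lt_of_lt_of_le (by positivity) hQ
    exact_mod_cast this
  obtain ⟨C, hC⟩ := typeSampler_space hB Q D
    (fun i => (H i).pattern ℓ (H i).V.equivFin.symm) k
  refine ⟨_, C, fun n G hV hG hE σ hσ => ⟨hC n G hV hG hE σ hσ, ?_⟩⟩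
  refine typeSampler_correct enum hB H hT hH (fun i => DRGraph.card_V_le (hb i) (hH i)) hθ
    (hNθ.trans (min_le_right _ _)) (hNθ.trans (min_le_left _ _)) hQpos ?_ hV hG hE hσ
  rw [mul_comm δ]
  exact (div_le_iff₀ hδ).1 hQ
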